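/- Let $m\ge 3$ be an integer. In $\mathbb{R}^m$ put $H_{ij}=\{x : x_i=x_j\}$ for $1\le i<j\le m$, and $H_{pqrs}=\{x : x_p+x_q=x_r+x_s\}$ for all $(p,q,r,s)$ with $1\le p<q\le m$, $p<r<s\le m$ and $p,q,r,s$ distinct. Let $\mathcal{A}_m$ (the mid-hyperplane arrangement) be the set of all these hyperplanes $H_{ij}$ and $H_{pqrs}$. Let $L$ be the set of all intersections of subfamilies of $\mathcal{A}_m$ (including $\mathbb{R}^m$, the intersection of the empty subfamily), partially ordered by reverse inclusion, and let $\mu:L\to\mathbb{Z}$ be its Möbius function: $\mu(\mathbb{R}^m)=1$ and $\sum_{Y\in L,\,Y\supseteq X}\mu(Y)=0$ for every $X\in L$ with $X\ne\mathbb{R}^m$. Let $$\chi(\mathcal{A}_m,t)=\sum_{X\in L}\mu(X)\,t^{\dim X}\in\mathbb{Z}[t]$$ be the characteristic polynomial of $\mathcal{A}_m$. Then $\chi(\mathcal{A}_m,t)$ is a product of linear factors in $\mathbb{Z}[t]$ if and only if $m\le 7$. -/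

import Mathlib

open Polynomial

/-- The intersection poset `L(A)` of an arrangement `A` of linear hyperplanes in `V`: all
intersections of subfamilies of `A` (the empty subfamily gives `V` itself), ordered by reverse
inclusion.  All members contain `0`, so no intersection is empty. -/
abbrev IntersectionLattice {K V : Type*} [Field K] [AddCommGroup V] [Module K V]
    (A : Set (Submodule K V)) : Type _ :=
  {X : (Submodule K V)ᵒᵈ // ∃ B : Set (Submodule K V), B ⊆ A ∧ OrderDual.ofDual X = sInf B}

namespace IntersectionLattice

variable {K V : Type*} [Field K] [AddCommGroup V] [Module K V]

/-- The edge `X ∈ L(A)` as a subspace of `V`. -/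
def toSubmodule {A : Set (Submodule K V)} (X : IntersectionLattice A) : Submodule K V :=
  OrderDual.ofDual X.1

/-- The whole space `V`, the least element of `L(A)`. -/
def whole (A : Set (Submodule K V)) : IntersectionLattice A :=
  ⟨OrderDual.toDual ⊤, ∅, Set.empty_subset A, by simp⟩

/-- The order of `L(A)` is reverse inclusion. -/
theorem le_iff {A : Set (Submodule K V)} (X Y : IntersectionLattice A) :
    X ≤ Y ↔ Y.toSubmodule ≤ X.toSubmodule := Iff.rfl

/-- A finite arrangement has a finite intersection poset. -/
instance instFinite (A : Set (Submodule K V)) [Finite A] : Finite (IntersectionLattice A) := by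
  have hA : A.Finite := Set.toFinite A
  have h : (sInf '' {B : Set (Submodule K V) | B ⊆ A}).Finite := hA.finite_subsets.image _
  have : Finite (sInf '' {B : Set (Submodule K V) | B ⊆ A}) := h
  refine Finite.of_injective
    (fun X : IntersectionLattice A =>
      (⟨X.toSubmodule, by
        obtain ⟨B, hB, hX⟩ := X.2
        exact ⟨B, hB, hX.symm⟩⟩ : (sInf '' {B : Set (Submodule K V) | B ⊆ A} : Set _))) ?_
  intro X Y hXY
  have h2 : X.toSubmodule = Y.toSubmodule := by simpa using hXY
  exact Subtype.ext (congrArg OrderDual.toDual h2)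

noncomputable instance instFintype (A : Set (Submodule K V)) [Finite A] :
    Fintype (IntersectionLattice A) := Fintype.ofFinite _

open Classical in
noncomputable instance instLocallyFiniteOrder (A : Set (Submodule K V)) [Finite A] :
    LocallyFiniteOrder (IntersectionLattice A) := Fintype.toLocallyFiniteOrder

end IntersectionLattice

open Classical in
/-- The Möbius function `μ(X) = μ(V, X)` of `L(A)`: `μ(V) = 1` and, for `X > V`,
`∑_{Y ≤ X} μ(Y) = 0`. -/
noncomputable def arrangementMoebius {K V : Type*} [Field K] [AddCommGroup V] [Module K V]
    (A : Set (Submodule K V)) [Finite A] (X : IntersectionLattice A) : ℤ :=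
  IncidenceAlgebra.mu ℤ (IntersectionLattice.whole A) X

/-- The characteristic polynomial `χ(A, t) = ∑_{X ∈ L(A)} μ(X) t ^ dim X`. -/
noncomputable def arrangementCharPoly {K V : Type*} [Field K] [AddCommGroup V] [Module K V]
    (A : Set (Submodule K V)) [Finite A] : ℤ[X] :=
  ∑ X : IntersectionLattice A,
    C (arrangementMoebius A X) * Polynomial.X ^ Module.finrank K X.toSubmodule

/-- The hyperplane `H_{ij} : x_i = x_j` in `K ^ m`. -/
def braidHyperplane (K : Type*) [Field K] (m : ℕ) (i j : Fin m) : Submodule K (Fin m → K) where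
  carrier := {x | x i = x j}
  zero_mem' := rfl
  add_mem' := by
    intro x y hx hy
    simp only [Set.mem_ofPred_eq] at hx hy
    simp [hx, hy]
  smul_mem' := by
    intro c x hx
    simp only [Set.mem_ofPred_eq] at hx
    simp [hx]

/-- The hyperplane `H_{pqrs} : x_p + x_q = x_r + x_s` in `K ^ m`. -/
def midHyperplane (K : Type*) [Field K] (m : ℕ) (p q r s : Fin m) :
    Submodule K (Fin m → K) where
  carrier := {x | x p + x q = x r + x s}
  zero_mem' := rfl
  add_mem' := by
    intro x y hx hy
    simp only [Set.mem_ofPred_eq, Pi.add_apply] at hx hy ⊢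
    rw [add_add_add_comm, hx, hy, add_add_add_comm]
  smul_mem' := by
    intro c x hx
    simp only [Set.mem_ofPred_eq, Pi.smul_apply, smul_eq_mul] at hx ⊢
    rw [← mul_add, hx, mul_add]

/-- The braid arrangement `B_m = {H_{ij} : i < j}`. -/
def braidArrangement (K : Type*) [Field K] (m : ℕ) : Set (Submodule K (Fin m → K)) :=
  {H | ∃ i j : Fin m, i < j ∧ H = braidHyperplane K m i j}

/-- The mid-hyperplane arrangement `A_m`: the braid arrangement together with all `H_{pqrs}`
with `p < q`, `p < r < s` and `p, q, r, s` distinct. -/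
def midHyperplaneArrangement (K : Type*) [Field K] (m : ℕ) : Set (Submodule K (Fin m → K)) :=
  braidArrangement K m ∪
    {H | ∃ p q r s : Fin m, p < q ∧ p < r ∧ r < s ∧ q ≠ r ∧ q ≠ s ∧
      H = midHyperplane K m p q r s}

instance midHyperplaneArrangement.instFinite (K : Type*) [Field K] (m : ℕ) :
    Finite (midHyperplaneArrangement K m) := by
  have h1 : (Set.range fun t : Fin m × Fin m => braidHyperplane K m t.1 t.2).Finite :=
    Set.finite_range _
  have h2 : (Set.range fun t : Fin m × Fin m × Fin m × Fin m =>
      midHyperplane K m t.1 t.2.1 t.2.2.1 t.2.2.2).Finite := Set.finite_range _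
  refine ((h1.union h2).subset ?_)
  rintro H (⟨i, j, -, rfl⟩ | ⟨p, q, r, s, -, -, -, -, -, rfl⟩)
  · exact Or.inl ⟨(i, j), rfl⟩
  · exact Or.inr ⟨(p, q, r, s), rfl⟩

/-- `f` is a product of linear factors in `ℤ[t]`. -/
def IsProductOfLinearFactors (f : ℤ[X]) : Prop :=
  ∃ s : Multiset ℤ[X], (∀ g ∈ s, g.degree = 1) ∧ f = s.prod

/-! Whitney's theorem turns the characteristic polynomial into a signed sum over subfamilies `B` of
hyperplanes, in which `B` contributes `(-1)^#B * t^(m - rank B)`. Everything else is information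
about these ranks, and each direction of the equivalence uses it differently.

For `3 ≤ m ≤ 7` the polynomial is found by interpolation. If a prime `q` does not divide `m` and
`4^(m-1) < q^2 * m`, ranks over `ZMod q` and over `ℝ` agree: a determinant of distinct normals, with
one row possibly all ones, is `m * k`, and Hadamard's inequality gives `k^2 * m ≤ 4^(m-1)`, so `q`
cannot divide a nonzero `k`. Hence the value at `q` counts the points of `(ZMod q)^m` off all the
hyperplanes (`eval_arrangementCharPoly`). Such points are the enumerations of `m`-subsets in which
no two disjoint pairs have equal sums. Affine symmetry reduces the count to subsets containing 0 and
1, which a verified bit-mask search evaluates. The leading coefficients, the roots 0 and 1, and the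
values at a few primes determine the polynomial.

For `m ≥ 8` the second coefficient rules out a factorization. With `n` hyperplanes it is `n.choose
2` plus a correction `d` from dependent families of rank two. Such a family involves at most six
coordinates, so `d` is a combination of `m.choose k` with `k ≤ 6`, whose coefficients follow from
the factorizations for `m = 3, 4, 5, 6` (`dependentRankTwoSum_eq`). If all roots are real,
Cauchy-Schwarz on the `m - 2` roots left after removing 0 and 1 gives `(n - 1)^2 ≤ (m - 2) * (n - 1
- 2 * d)`. The left side grows like `m^8 / 64` and the right side like `5 * m^7 / 24`; the
inequality already fails at `m = 8`. -/

open Finset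

/-! ### Whitney's formula for the Möbius function and the characteristic polynomial. -/

section Whitney

variable {K V : Type*} [Field K] [AddCommGroup V] [Module K V]

open Classical in
theorem sum_arrangementMoebius_le {A : Set (Submodule K V)} [Finite A]
    (X : IntersectionLattice A) :
    ∑ Y : IntersectionLattice A with Y ≤ X, arrangementMoebius A Y
      = if IntersectionLattice.whole A = X then 1 else 0 := by
  rw [← IncidenceAlgebra.sum_Icc_mu_right]
  refine Finset.sum_congr ?_ fun _ _ => rfl
  ext Y
  simp only [Finset.mem_filter, Finset.mem_univ, true_and, Finset.mem_Icc]
  refine ⟨fun h => ⟨?_, h⟩, fun h => h.2⟩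
  rw [IntersectionLattice.le_iff]
  exact le_top

/-- Two functions on the intersection poset with the same lower sums coincide. -/
theorem IntersectionLattice.eq_of_sum_le_eq {A : Set (Submodule K V)} [Finite A]
    {f g : IntersectionLattice A → ℤ}
    (h : ∀ X, (open Classical in ∑ Y : IntersectionLattice A with Y ≤ X, f Y) =
      (open Classical in ∑ Y : IntersectionLattice A with Y ≤ X, g Y)) : f = g := by
  classical
  ext X
  induction X using WellFoundedLT.induction with
  | ind X ih =>
    have hX := h X
    have hs : (univ.filter fun Y : IntersectionLattice A => Y ≤ X)
        = insert X (univ.filter fun Y : IntersectionLattice A => Y < X) := by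
      ext Y
      simp [le_iff_eq_or_lt]
    rw [hs, sum_insert (by simp), sum_insert (by simp),
      sum_congr rfl fun Y hY => ih Y (by simpa using hY)] at hX
    exact add_right_cancel hX

variable {ι : Type*} (s : Finset ι) (h : ι → Submodule K V)

/-- The edge cut out by the hyperplanes indexed by `B`. -/
def IntersectionLattice.ofFinset {A : Set (Submodule K V)} (hA : A = h '' s) (B : Finset ι)
    (hB : B ⊆ s) : IntersectionLattice A :=
  ⟨OrderDual.toDual (⨅ i ∈ B, h i), h '' B, by rw [hA]; gcongr, by
    simp [sInf_image]⟩

-- Both sides have the same sums over lower sets. On the right, summing over all edges `Y ≤ X`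
-- removes the constraint on the intersection and leaves the alternating sum over all families of
-- hyperplanes containing `X`, which is 0 unless no hyperplane contains `X`, that is, unless `X` is
-- the whole space.
open Classical in
theorem arrangementMoebius_eq_sum {A : Set (Submodule K V)} [Finite A] (hA : A = h '' s)
    (htop : ∀ i ∈ s, h i ≠ ⊤) (X : IntersectionLattice A) :
    arrangementMoebius A X =
      ∑ B ∈ s.powerset with (⨅ i ∈ B, h i) = X.toSubmodule, (-1 : ℤ) ^ #B := by
  revert X
  rw [← funext_iff]
  refine IntersectionLattice.eq_of_sum_le_eq fun X => ?_
  rw [sum_arrangementMoebius_le]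
  have key : ∑ Y : IntersectionLattice A with Y ≤ X,
        ∑ B ∈ s.powerset with (⨅ i ∈ B, h i) = Y.toSubmodule, (-1 : ℤ) ^ #B
      = ∑ B ∈ (s.filter fun i => X.toSubmodule ≤ h i).powerset, (-1 : ℤ) ^ #B := by
    rw [sum_sigma']
    refine sum_bij' (fun p _ => p.2)
      (fun B hB => ⟨IntersectionLattice.ofFinset s h hA B
        ((mem_powerset.1 hB).trans (filter_subset _ _)), B⟩) ?_ ?_ ?_ ?_ ?_
    · rintro ⟨Y, B⟩ hp
      simp only [mem_sigma, mem_filter, mem_univ, true_and, mem_powerset,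
        IntersectionLattice.le_iff] at hp
      rw [mem_powerset]
      intro i hi
      refine mem_filter.2 ⟨hp.2.1 hi, hp.1.trans ?_⟩
      rw [← hp.2.2]
      exact iInf₂_le i hi
    · intro B hB
      have hB' := mem_powerset.1 hB
      simp only [mem_sigma, mem_filter, mem_univ, true_and, mem_powerset,
        IntersectionLattice.le_iff]
      refine ⟨?_, hB'.trans (filter_subset _ _), rfl⟩
      exact le_iInf₂ fun i hi => (mem_filter.1 (hB' hi)).2
    · rintro ⟨Y, B⟩ hp
      simp only [mem_sigma, mem_filter, mem_univ, true_and, mem_powerset] at hp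
      have : IntersectionLattice.ofFinset s h hA B hp.2.1 = Y :=
        Subtype.ext (congrArg OrderDual.toDual hp.2.2)
      simp [this]
    · intro B hB
      rfl
    · intro p _
      rfl
  rw [key, sum_powerset_neg_one_pow_card]
  congr 1
  rw [eq_iff_iff, filter_eq_empty_iff]
  constructor
  · rintro rfl i hi hle
    exact htop i hi (top_le_iff.1 hle)
  · intro hX
    obtain ⟨X, B, hB, hXB⟩ := X
    refine Subtype.ext (congrArg OrderDual.toDual ?_)
    change ⊤ = OrderDual.ofDual X
    -- A member of `B` would be a hyperplane containing `X`, and there is none.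
    have hBe : B = ∅ := by
      rw [Set.eq_empty_iff_forall_notMem]
      intro H hH
      obtain ⟨i, hi, rfl⟩ := hA ▸ hB hH
      refine hX (Finset.mem_coe.1 hi) ?_
      change OrderDual.ofDual X ≤ _
      rw [hXB]
      exact sInf_le hH
    rw [hXB, hBe, sInf_empty]

/-- Whitney's theorem for the characteristic polynomial. -/
theorem arrangementCharPoly_eq_sum_powerset {A : Set (Submodule K V)} [Finite A]
    (hA : A = h '' s) (htop : ∀ i ∈ s, h i ≠ ⊤) :
    arrangementCharPoly A =
      ∑ B ∈ s.powerset, C ((-1 : ℤ) ^ #B) *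
        Polynomial.X ^ Module.finrank K (⨅ i ∈ B, h i : Submodule K V) := by
  classical
  unfold arrangementCharPoly
  simp_rw [arrangementMoebius_eq_sum s h hA htop, map_sum, sum_mul]
  rw [sum_sigma']
  refine sum_bij' (fun p _ => p.2)
    (fun B hB => ⟨IntersectionLattice.ofFinset s h hA B (mem_powerset.1 hB), B⟩) ?_ ?_ ?_ ?_ ?_
  · rintro ⟨Y, B⟩ hp
    simp only [mem_sigma, mem_filter, mem_univ, true_and] at hp
    exact hp.1
  · intro B hB
    simp only [mem_sigma, mem_filter, mem_univ, true_and]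
    exact ⟨hB, rfl⟩
  · rintro ⟨Y, B⟩ hp
    simp only [mem_sigma, mem_filter, mem_univ, true_and, mem_powerset] at hp
    have : IntersectionLattice.ofFinset s h hA B hp.1 = Y :=
      Subtype.ext (congrArg OrderDual.toDual hp.2)
    simp [this]
  · intro B hB
    rfl
  · rintro ⟨Y, B⟩ hp
    simp only [mem_sigma, mem_filter, mem_univ, true_and] at hp
    change _ * Polynomial.X ^ Module.finrank K Y.toSubmodule = _
    rw [hp.2]

end Whitney

/-! ### Integral normal vectors of the hyperplanes. -/

section Normals

/-- The normal vector of `x_i = x_j`. -/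
def pairNormal {m : ℕ} (i j : Fin m) : Fin m → ℤ := Pi.single i 1 - Pi.single j 1

/-- The normal vector of `x_p + x_q = x_r + x_s`. -/
def quadNormal {m : ℕ} (p q r s : Fin m) : Fin m → ℤ :=
  Pi.single p 1 + Pi.single q 1 - Pi.single r 1 - Pi.single s 1

/-- The index quadruples of the mid-hyperplanes. -/
def IsMidIndex {m : ℕ} (p q r s : Fin m) : Prop := p < q ∧ p < r ∧ r < s ∧ q ≠ r ∧ q ≠ s

instance {m : ℕ} (p q r s : Fin m) : Decidable (IsMidIndex p q r s) :=
  inferInstanceAs (Decidable (_ ∧ _))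

/-- The normal vectors of the mid-hyperplane arrangement. -/
def midNormals (m : ℕ) : Finset (Fin m → ℤ) :=
  ((univ : Finset (Fin m × Fin m)).filter fun t => t.1 < t.2).image
      (fun t => pairNormal t.1 t.2) ∪
    ((univ : Finset (Fin m × Fin m × Fin m × Fin m)).filter fun t =>
      IsMidIndex t.1 t.2.1 t.2.2.1 t.2.2.2).image
      (fun t => quadNormal t.1 t.2.1 t.2.2.1 t.2.2.2)

variable {m : ℕ} {v w : Fin m → ℤ}

theorem mem_midNormals : v ∈ midNormals m ↔ (∃ i j, i < j ∧ v = pairNormal i j) ∨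
    ∃ p q r s, IsMidIndex p q r s ∧ v = quadNormal p q r s := by
  simp only [midNormals, mem_union, mem_image, mem_filter, mem_univ, true_and, Prod.exists]
  simp only [eq_comm]

theorem pairNormal_mem {i j : Fin m} (h : i < j) : pairNormal i j ∈ midNormals m :=
  mem_midNormals.2 (Or.inl ⟨i, j, h, rfl⟩)

theorem quadNormal_mem {p q r s : Fin m} (h : IsMidIndex p q r s) :
    quadNormal p q r s ∈ midNormals m :=
  mem_midNormals.2 (Or.inr ⟨p, q, r, s, h, rfl⟩)

theorem sum_pairNormal_mul {R : Type*} [CommRing R] (i j : Fin m) (x : Fin m → R) :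
    ∑ k, (pairNormal i j k : R) * x k = x i - x j := by
  simp [pairNormal, sub_mul, Pi.single_apply]

theorem sum_quadNormal_mul {R : Type*} [CommRing R] (p q r s : Fin m) (x : Fin m → R) :
    ∑ k, (quadNormal p q r s k : R) * x k = x p + x q - x r - x s := by
  simp [quadNormal, sub_mul, add_mul, Pi.single_apply, sum_add_distrib]

/-- The hyperplane with an integral normal vector. -/
def normalHyperplane (F : Type*) [Field F] (v : Fin m → ℤ) : Submodule F (Fin m → F) :=
  LinearMap.ker (Fintype.linearCombination F fun i => (v i : F))

theorem mem_normalHyperplane {F : Type*} [Field F] {x : Fin m → F} :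
    x ∈ normalHyperplane F v ↔ ∑ k, (v k : F) * x k = 0 := by
  simp [normalHyperplane, Fintype.linearCombination_apply, mul_comm]

theorem normalHyperplane_pairNormal (F : Type*) [Field F] (i j : Fin m) :
    normalHyperplane F (pairNormal i j) = braidHyperplane F m i j := by
  ext x
  rw [mem_normalHyperplane, sum_pairNormal_mul, sub_eq_zero]
  rfl

theorem normalHyperplane_quadNormal (F : Type*) [Field F] (p q r s : Fin m) :
    normalHyperplane F (quadNormal p q r s) = midHyperplane F m p q r s := by
  ext x
  rw [mem_normalHyperplane, sum_quadNormal_mul, sub_sub, sub_eq_zero]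
  rfl

theorem midHyperplaneArrangement_eq_image (F : Type*) [Field F] (m : ℕ) :
    midHyperplaneArrangement F m = normalHyperplane F '' (midNormals m : Set (Fin m → ℤ)) := by
  ext H
  simp only [midHyperplaneArrangement, braidArrangement, Set.mem_union, Set.mem_ofPred_eq,
    Set.mem_image, Finset.mem_coe]
  constructor
  · rintro (⟨i, j, hij, rfl⟩ | ⟨p, q, r, s, h1, h2, h3, h4, h5, rfl⟩)
    · exact ⟨_, pairNormal_mem hij, normalHyperplane_pairNormal F i j⟩
    · exact ⟨_, quadNormal_mem ⟨h1, h2, h3, h4, h5⟩, normalHyperplane_quadNormal F p q r s⟩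
  · rintro ⟨v, hv, rfl⟩
    rcases mem_midNormals.1 hv with ⟨i, j, hij, rfl⟩ | ⟨p, q, r, s, ⟨h1, h2, h3, h4, h5⟩, rfl⟩
    · exact Or.inl ⟨i, j, hij, normalHyperplane_pairNormal F i j⟩
    · exact Or.inr ⟨p, q, r, s, h1, h2, h3, h4, h5, normalHyperplane_quadNormal F p q r s⟩

theorem sum_eq_zero_of_mem_midNormals (hv : v ∈ midNormals m) : ∑ k, v k = 0 := by
  rcases mem_midNormals.1 hv with ⟨i, j, -, rfl⟩ | ⟨p, q, r, s, -, rfl⟩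
  · simpa using sum_pairNormal_mul (R := ℤ) i j 1
  · simpa using sum_quadNormal_mul (R := ℤ) p q r s 1

/-- The index conventions `i < j` and `p < q, r, s` fix the sign: the leading nonzero entry is 1.
This makes normals nonzero over every field and distinct normals non-proportional in characteristic
zero. -/
theorem exists_first_eq_one_of_mem_midNormals (hv : v ∈ midNormals m) :
    ∃ p, v p = 1 ∧ ∀ k < p, v k = 0 := by
  rcases mem_midNormals.1 hv with ⟨i, j, hij, rfl⟩ | ⟨p, q, r, s, ⟨h1, h2, h3, h4, h5⟩, rfl⟩
  · refine ⟨i, ?_, fun k hk => ?_⟩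
    · simp [pairNormal, hij.ne]
    · simp [pairNormal, hk.ne, (hk.trans hij).ne]
  · refine ⟨p, ?_, fun k hk => ?_⟩
    · simp [quadNormal, h1.ne, h2.ne, (h2.trans h3).ne]
    · simp [quadNormal, hk.ne, (hk.trans h1).ne, (hk.trans h2).ne, (hk.trans (h2.trans h3)).ne]

/-- The squared lengths are 2 and 4; this is the source of the 4 in the Hadamard bound. -/
theorem sum_sq_le_of_mem_midNormals (hv : v ∈ midNormals m) : ∑ k, v k ^ 2 ≤ 4 := by
  rcases mem_midNormals.1 hv with ⟨i, j, hij, rfl⟩ | ⟨p, q, r, s, ⟨h1, h2, h3, h4, h5⟩, rfl⟩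
  · have := sum_pairNormal_mul (R := ℤ) i j (pairNormal i j)
    simp_rw [sq]
    simp only [Int.cast_id] at this
    rw [this]
    simp [pairNormal, hij.ne, hij.ne']
  · have := sum_quadNormal_mul (R := ℤ) p q r s (quadNormal p q r s)
    simp_rw [sq]
    simp only [Int.cast_id] at this
    rw [this]
    simp [quadNormal, h1.ne, h2.ne, h3.ne, h4, h5, h1.ne', h2.ne', h3.ne', h4.symm, h5.symm,
      (h2.trans h3).ne, (h2.trans h3).ne']

theorem card_support_le_of_mem_midNormals (hv : v ∈ midNormals m) : #{k | v k ≠ 0} ≤ 4 := by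
  have h := sum_sq_le_of_mem_midNormals hv
  have : (#{k | v k ≠ 0} : ℤ) ≤ ∑ k, v k ^ 2 := by
    rw [← sum_filter_add_sum_filter_not univ (fun k => v k ≠ 0), card_eq_sum_ones]
    push_cast
    refine le_add_of_le_of_nonneg (sum_le_sum fun k hk => ?_) (sum_nonneg fun _ _ => sq_nonneg _)
    have := (mem_filter.1 hk).2
    have h2 : 0 < v k ^ 2 := by positivity
    exact h2
  omega

/-- Distinct normal vectors are not proportional. -/
theorem eq_zero_of_smul_eq_smul {F : Type*} [Field F] [CharZero F] (hv : v ∈ midNormals m)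
    (hw : w ∈ midNormals m) (hvw : v ≠ w) {a b : F}
    (h : ∀ k, a * (v k : F) = b * (w k : F)) : a = 0 ∧ b = 0 := by
  obtain ⟨p, hp, hp'⟩ := exists_first_eq_one_of_mem_midNormals hv
  obtain ⟨q, hq, hq'⟩ := exists_first_eq_one_of_mem_midNormals hw
  have h1 := h p
  have h2 := h q
  rw [hp] at h1
  rw [hq] at h2
  rcases lt_trichotomy p q with hpq | rfl | hpq
  · have ha : a = 0 := by simpa [hq' p hpq] using h1
    subst ha
    exact ⟨rfl, by simpa using h2.symm⟩
  · have hab : a = b := by simpa [hq] using h1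
    subst hab
    by_contra hne
    have ha : a ≠ 0 := by tauto
    refine hvw (funext fun k => ?_)
    exact_mod_cast mul_left_cancel₀ ha (h k)
  · have hb : b = 0 := by simpa [hp' q hpq] using h2.symm
    subst hb
    exact ⟨by simpa using h1, rfl⟩

end Normals

/-! ### Rank of a family of normals and dimension of the intersection. -/

section Rank

variable {m : ℕ} (F : Type*) [Field F]

/-- An integral vector with its entries read in `F`. -/
def castVec (v : Fin m → ℤ) : Fin m → F := fun i => (v i : F)

/-- The rank over `F` of a finite set of integral vectors. -/
noncomputable def normalRank (B : Finset (Fin m → ℤ)) : ℕ :=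
  Module.finrank F (Submodule.span F (castVec F '' (B : Set (Fin m → ℤ))))

theorem finrank_iInf_normalHyperplane_add (B : Finset (Fin m → ℤ)) :
    Module.finrank F (⨅ v ∈ B, normalHyperplane F v : Submodule F (Fin m → F)) +
      normalRank F B = m := by
  let M : Matrix B (Fin m) F := Matrix.of fun v => castVec F v.1
  have h1 : (⨅ v ∈ B, normalHyperplane F v : Submodule F (Fin m → F))
      = LinearMap.ker M.mulVecLin := by
    ext x
    simp only [Submodule.mem_iInf, mem_normalHyperplane, LinearMap.mem_ker, funext_iff]
    simp [Matrix.mulVec, dotProduct, M, castVec]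
  have h2 : normalRank F B = Module.finrank F (LinearMap.range M.mulVecLin) := by
    change _ = M.rank
    have h3 : castVec F '' (B : Set (Fin m → ℤ)) = Set.range M.row := by
      rw [Set.image_eq_range]
      rfl
    rw [Matrix.rank_eq_finrank_span_row, normalRank, h3]
  rw [h1, h2, add_comm, LinearMap.finrank_range_add_finrank_ker]
  simp

end Rank

/-! ### Good reduction: ranks modulo `q` agree with real ranks. -/

section RankTransfer

/-- Hadamard's inequality for real matrices. -/
theorem Matrix.abs_det_le_prod_norm_row {m : ℕ} (M : Matrix (Fin m) (Fin m) ℝ) :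
    |M.det| ≤ ∏ i, ‖WithLp.toLp 2 (M i)‖ := by
  have : Fact (Module.finrank ℝ (EuclideanSpace ℝ (Fin m)) = m) := ⟨by simp⟩
  let b := EuclideanSpace.basisFun (Fin m) ℝ
  have h := Orientation.abs_volumeForm_apply_le b.toBasis.orientation
    (fun i => WithLp.toLp 2 (M i))
  rw [Orientation.volumeForm_robust' _ b] at h
  refine le_trans (le_of_eq ?_) h
  rw [Module.Basis.det_apply, ← Matrix.det_transpose]
  congr 2

theorem Matrix.det_sq_le_prod_sum_sq {m : ℕ} (M : Matrix (Fin m) (Fin m) ℤ) :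
    M.det ^ 2 ≤ ∏ i, ∑ j, M i j ^ 2 := by
  have h := Matrix.abs_det_le_prod_norm_row (M.map (Int.castRingHom ℝ))
  have h2 : (M.map (Int.castRingHom ℝ)).det = (M.det : ℝ) := by
    simpa using (RingHom.map_det (Int.castRingHom ℝ) M).symm
  rw [h2] at h
  have h3 := pow_le_pow_left₀ (abs_nonneg _) h 2
  rw [sq_abs, ← prod_pow] at h3
  have h4 : ∀ i, ‖WithLp.toLp 2 (M.map (Int.castRingHom ℝ) i)‖ ^ 2
      = ((∑ j, M i j ^ 2 : ℤ) : ℝ) := by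
    intro i
    rw [EuclideanSpace.norm_sq_eq]
    simp
  simp_rw [h4] at h3
  exact_mod_cast h3

variable {m : ℕ}

/-- A determinant whose rows are distinct normal vectors, one of them possibly replaced by the
all-ones vector, is a multiple of `m` of restricted size. -/
theorem exists_det_eq_mul_of_mem_midNormals {f : Fin m → Fin m → ℤ} (hf : Function.Injective f)
    (hm : ∀ i, f i ∈ insert 1 (midNormals m)) (hpos : 0 < m) :
    ∃ k : ℤ, (Matrix.of f).det = m * k ∧ k ^ 2 * m ≤ 4 ^ (m - 1) := by
  set M := Matrix.of f with hM
  -- Normals have coordinate sum 0, so `M.mulVec 1` vanishes except for the entry `m` at an all-ones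
  -- row. Applying the adjugate shows that the determinant is `m` times a cofactor, or 0 if there is
  -- no such row.
  have hadj : M.det • (1 : Fin m → ℤ) = M.adjugate.mulVec (M.mulVec 1) := by
    rw [Matrix.mulVec_mulVec, Matrix.adjugate_mul, Matrix.smul_mulVec, Matrix.one_mulVec]
  have hrow : ∀ i, f i ≠ 1 → M.mulVec 1 i = 0 := by
    intro i hi
    have := sum_eq_zero_of_mem_midNormals ((mem_insert.1 (hm i)).resolve_left hi)
    simpa [Matrix.mulVec, dotProduct, M] using this
  have hd := congrFun hadj ⟨0, hpos⟩
  simp only [Pi.smul_apply, Pi.one_apply, smul_eq_mul, mul_one] at hd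
  by_cases h1 : ∃ i, f i = 1
  · obtain ⟨i₀, hi₀⟩ := h1
    have hne : ∀ i, i ≠ i₀ → f i ≠ 1 := fun i hi h => hi (hf (h.trans hi₀.symm))
    have hdet : M.det = m * M.adjugate ⟨0, hpos⟩ i₀ := by
      rw [hd, Matrix.mulVec, dotProduct, sum_eq_single i₀]
      · have : M.mulVec 1 i₀ = m := by simp [Matrix.mulVec, dotProduct, M, hi₀]
        rw [this, mul_comm]
      · intro i _ hi
        rw [hrow i (hne i hi), mul_zero]
      · simp
    refine ⟨M.adjugate ⟨0, hpos⟩ i₀, hdet, ?_⟩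
    -- Hadamard gives `(m * k)^2 ≤ m * 4^(m-1)`, the all-ones row contributing `m`; one factor `m`
    -- cancels.
    · have hb := M.det_sq_le_prod_sum_sq
      rw [← mul_prod_erase univ _ (mem_univ i₀)] at hb
      have hb2 : ∏ i ∈ univ.erase i₀, ∑ j, M i j ^ 2 ≤ (4 : ℤ) ^ (m - 1) := by
        have hc : #((univ : Finset (Fin m)).erase i₀) = m - 1 := by
          rw [card_erase_of_mem (mem_univ _)]; simp
        rw [← hc, ← prod_const]
        refine prod_le_prod ?_ ?_
        · intro i _
          exact sum_nonneg fun _ _ => sq_nonneg _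
        · intro i hi
          exact sum_sq_le_of_mem_midNormals
            ((mem_insert.1 (hm i)).resolve_left (hne i (mem_erase.1 hi).1))
      have hb3 : ∑ j, M i₀ j ^ 2 = m := by simp [M, hi₀]
      rw [hb3, hdet] at hb
      have hm0 : (0 : ℤ) < m := by exact_mod_cast hpos
      have := hb.trans (mul_le_mul_of_nonneg_left hb2 hm0.le)
      refine le_of_mul_le_mul_left (le_trans (le_of_eq ?_) this) hm0
      ring
  · push Not at h1
    refine ⟨0, ?_, by simp⟩
    rw [hd, Matrix.mulVec, dotProduct, mul_zero]
    exact sum_eq_zero fun i _ => by rw [hrow i (h1 i), mul_zero]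

/-- Summing `e_i - e_j` over `j` and adding the all-ones vector gives `m • e_i`, and `m` is
invertible. The all-ones vector is needed because the normals alone span at most the sum-zero
hyperplane. -/
theorem span_castVec_insert_one {F : Type*} [Field F] (hm : (m : F) ≠ 0) :
    Submodule.span F (castVec F '' ((insert 1 (midNormals m) : Finset (Fin m → ℤ)) : Set (Fin m → ℤ))) = ⊤ := by
  set S := Submodule.span F (castVec F '' ((insert 1 (midNormals m) : Finset (Fin m → ℤ)) : Set (Fin m → ℤ)))
  have hmem : ∀ v ∈ insert 1 (midNormals m), castVec F v ∈ S := fun v hv =>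
    Submodule.subset_span ⟨v, hv, rfl⟩
  have hone : (1 : Fin m → F) ∈ S := by
    have := hmem 1 (mem_insert_self _ _)
    convert this using 1
    ext i
    simp [castVec]
  have hpair : ∀ i j : Fin m, i < j → (Pi.single i 1 - Pi.single j 1 : Fin m → F) ∈ S := by
    intro i j hij
    have := hmem _ (mem_insert_of_mem (pairNormal_mem hij))
    convert this using 1
    ext k
    simp [castVec, pairNormal, Pi.single_apply]
  have hdiff : ∀ i j : Fin m, (Pi.single i 1 - Pi.single j 1 : Fin m → F) ∈ S := by
    intro i j
    rcases lt_trichotomy i j with h | rfl | h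
    · exact hpair i j h
    · simp
    · rw [← neg_sub]
      exact S.neg_mem (hpair j i h)
  have hsingle : ∀ i : Fin m, (Pi.single i 1 : Fin m → F) ∈ S := by
    intro i
    have h1 : ∑ j, (Pi.single i 1 - Pi.single j 1 : Fin m → F) + 1 = (m : F) • Pi.single i 1 := by
      rw [sum_sub_distrib]
      have : ∑ j : Fin m, (Pi.single j 1 : Fin m → F) = 1 := by
        ext k
        simp [Finset.sum_apply, Pi.single_apply]
      rw [this]
      ext k
      simp
    have h2 := S.add_mem (S.sum_mem fun j (_ : j ∈ univ) => hdiff i j) hone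
    rw [h1] at h2
    simpa [hm] using S.smul_mem (m : F)⁻¹ h2
  rw [eq_top_iff]
  intro x _
  rw [pi_eq_sum_univ' x]
  refine S.sum_mem fun i _ => S.smul_mem _ ?_
  convert hsingle i using 1

variable {F F' : Type*} [Field F] [Field F']

/-- Extend `C` to a basis over `F` by further normals and possibly the all-ones vector. Its
determinant is `m * k` with `k` bounded, and the hypotheses carry its nonvanishing from `F` to `F'`.
-/
theorem linearIndepOn_castVec_transfer (hm : (m : F) ≠ 0) (hm' : (m : F') ≠ 0)
    (hk : ∀ k : ℤ, k ^ 2 * m ≤ 4 ^ (m - 1) → (k : F) ≠ 0 → (k : F') ≠ 0)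
    {C : Finset (Fin m → ℤ)} (hC : C ⊆ midNormals m) (h : LinearIndepOn F (castVec F) (C : Set (Fin m → ℤ))) :
    LinearIndepOn F' (castVec F') (C : Set (Fin m → ℤ)) := by
  have hCE : (C : Set (Fin m → ℤ)) ⊆ (insert 1 (midNormals m) : Finset (Fin m → ℤ)) := by
    exact_mod_cast hC.trans (subset_insert _ _)
  obtain ⟨b, hbE, hCb, hspan, hb⟩ := exists_linearIndepOn_extension h hCE
  have hbfin : b.Finite := (Finset.finite_toSet _).subset hbE
  have := hbfin.fintype
  have htop : Submodule.span F (castVec F '' b) = ⊤ := by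
    rw [eq_top_iff, ← span_castVec_insert_one hm]
    exact Submodule.span_le.2 hspan
  have hcard : Fintype.card b = m := by
    have h1 := finrank_span_eq_card (LinearIndepOn.linearIndependent hb)
    have h2 : Set.range (fun x : b => castVec F x.1) = castVec F '' b := by
      rw [Set.image_eq_range]
    rw [h2, htop, finrank_top] at h1
    simpa using h1.symm
  let e : Fin m ≃ b := (Fintype.equivFinOfCardEq hcard).symm
  let f : Fin m → Fin m → ℤ := fun i => (e i).1
  have hf : Function.Injective f := Subtype.val_injective.comp e.injective
  obtain ⟨k, hdet, hkb⟩ := exists_det_eq_mul_of_mem_midNormals hf (fun i => hbE (e i).2)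
    (Nat.pos_of_ne_zero (by rintro rfl; simp at hm))
  have hdetF : ((Matrix.of f).map (Int.castRingHom F)).det = (m : F) * k := by
    have := RingHom.map_det (Int.castRingHom F) (Matrix.of f)
    rw [hdet] at this
    simpa using this.symm
  have hdetF' : ((Matrix.of f).map (Int.castRingHom F')).det = (m : F') * k := by
    have := RingHom.map_det (Int.castRingHom F') (Matrix.of f)
    rw [hdet] at this
    simpa using this.symm
  have hrows : LinearIndependent F ((Matrix.of f).map (Int.castRingHom F)).row :=
    (LinearIndepOn.linearIndependent hb).comp e e.injective
  rw [Matrix.linearIndependent_rows_iff_isUnit, Matrix.isUnit_iff_isUnit_det, hdetF,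
    isUnit_iff_ne_zero] at hrows
  have hrows' : LinearIndependent F' ((Matrix.of f).map (Int.castRingHom F')).row := by
    rw [Matrix.linearIndependent_rows_iff_isUnit, Matrix.isUnit_iff_isUnit_det, hdetF',
      isUnit_iff_ne_zero]
    exact mul_ne_zero hm' (hk k hkb (right_ne_zero_of_mul hrows))
  have hb' : LinearIndepOn F' (castVec F') b := by
    have := hrows'.comp e.symm e.symm.injective
    have heq : ((Matrix.of f).map (Int.castRingHom F')).row ∘ e.symm
        = fun x : b => castVec F' x.1 := by
      ext x i
      change (((e (e.symm x)).1 i : ℤ) : F') = _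
      rw [e.apply_symm_apply]
      rfl
    rw [heq] at this
    exact this
  exact hb'.mono hCb

theorem normalRank_le_of_transfer (hm : (m : F) ≠ 0) (hm' : (m : F') ≠ 0)
    (hk : ∀ k : ℤ, k ^ 2 * m ≤ 4 ^ (m - 1) → (k : F) ≠ 0 → (k : F') ≠ 0)
    {B : Finset (Fin m → ℤ)} (hB : B ⊆ midNormals m) : normalRank F B ≤ normalRank F' B := by
  obtain ⟨C, hCB, -, hspan, hC⟩ := exists_linearIndepOn_extension
    (linearIndepOn_empty F (castVec F)) (Set.empty_subset (B : Set (Fin m → ℤ)))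
  lift C to Finset (Fin m → ℤ) using (Finset.finite_toSet _).subset hCB
  have hCB' : C ⊆ B := by exact_mod_cast hCB
  have hC' := linearIndepOn_castVec_transfer hm hm' hk (hCB'.trans hB) hC
  have hrank : normalRank F B = #C := by
    have h1 := finrank_span_eq_card (LinearIndepOn.linearIndependent hC)
    have h2 : Submodule.span F (Set.range fun x : (C : Set (Fin m → ℤ)) => castVec F x.1)
        = Submodule.span F (castVec F '' (B : Set (Fin m → ℤ))) := by
      rw [← Set.image_eq_range]
      exact le_antisymm (Submodule.span_mono (Set.image_mono hCB)) (Submodule.span_le.2 hspan)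
    rw [h2] at h1
    simpa [normalRank] using h1
  have h1 := finrank_span_eq_card (LinearIndepOn.linearIndependent hC')
  rw [← Set.image_eq_range] at h1
  rw [hrank, normalRank]
  have h2 : #C = Fintype.card (C : Set (Fin m → ℤ)) := by simp
  rw [h2, ← h1]
  exact Submodule.finrank_mono (Submodule.span_mono (Set.image_mono hCB))

/-- A nonzero multiple `k` of `q` has `k^2 * m ≥ q^2 * m > 4^(m-1)`, so none of the relevant
cofactors dies modulo `q`. -/
theorem normalRank_zmod_eq {q : ℕ} [Fact q.Prime] (hqm : ¬ q ∣ m) (hq : 4 ^ (m - 1) < q ^ 2 * m)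
    {B : Finset (Fin m → ℤ)} (hB : B ⊆ midNormals m) :
    normalRank (ZMod q) B = normalRank ℝ B := by
  have hm' : (m : ZMod q) ≠ 0 := by rwa [Ne, ZMod.natCast_eq_zero_iff]
  have hm : (m : ℝ) ≠ 0 := by
    rintro h
    rw [Nat.cast_eq_zero] at h
    simp [h] at hqm
  refine le_antisymm (normalRank_le_of_transfer hm' hm ?_ hB)
    (normalRank_le_of_transfer hm hm' ?_ hB)
  · intro k _ hk h
    rw [Int.cast_eq_zero] at h
    simp [h] at hk
  · intro k hkm hk h
    rw [ZMod.intCast_zmod_eq_zero_iff_dvd] at h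
    obtain ⟨c, rfl⟩ := h
    have hc : c ≠ 0 := by rintro rfl; simp at hk
    have hc2 : 1 ≤ c ^ 2 := by
      have : 0 < c ^ 2 := by positivity
      exact this
    have hq' : (4 : ℤ) ^ (m - 1) < q ^ 2 * m := by exact_mod_cast hq
    have h3 : (q : ℤ) ^ 2 * m * 1 ≤ q ^ 2 * m * c ^ 2 :=
      mul_le_mul_of_nonneg_left hc2 (by positivity)
    have h4 : ((q : ℤ) * c) ^ 2 * m = q ^ 2 * m * c ^ 2 := by ring
    rw [h4] at hkm
    linarith

end RankTransfer

/-! ### The finite field method. -/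

section FiniteField

variable {m : ℕ}

theorem normalHyperplane_ne_top (F : Type*) [Field F] {v : Fin m → ℤ} (hv : v ∈ midNormals m) :
    normalHyperplane F v ≠ ⊤ := by
  obtain ⟨p, hp, -⟩ := exists_first_eq_one_of_mem_midNormals hv
  intro h
  have h1 : (Pi.single p 1 : Fin m → F) ∈ normalHyperplane F v := by rw [h]; trivial
  rw [mem_normalHyperplane] at h1
  simp [Pi.single_apply, hp] at h1

theorem arrangementCharPoly_eq_sum_normalRank (m : ℕ) :
    arrangementCharPoly (midHyperplaneArrangement ℝ m) =
      ∑ B ∈ (midNormals m).powerset, C ((-1 : ℤ) ^ #B) *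
        Polynomial.X ^ (m - normalRank ℝ B) := by
  rw [arrangementCharPoly_eq_sum_powerset (midNormals m) (normalHyperplane ℝ)
    (midHyperplaneArrangement_eq_image ℝ m) fun v hv => normalHyperplane_ne_top ℝ hv]
  refine sum_congr rfl fun B _ => ?_
  rw [← Nat.eq_sub_of_add_eq (finrank_iInf_normalHyperplane_add ℝ B)]

variable (q : ℕ) [Fact q.Prime]

/-- The points over `ZMod q` off all hyperplanes of the mid-hyperplane arrangement. -/
def complementPoints (m : ℕ) : Finset (Fin m → ZMod q) :=
  univ.filter fun x => ∀ v ∈ midNormals m, ∑ k, (v k : ZMod q) * x k ≠ 0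

/-- Inclusion-exclusion: the intersection of the hyperplanes in `B` has `q ^ (m - rank B)` points
over `ZMod q`. -/
theorem card_complementPoints (m : ℕ) :
    (#(complementPoints q m) : ℤ) =
      ∑ B ∈ (midNormals m).powerset, (-1 : ℤ) ^ #B * (q : ℤ) ^ (m - normalRank (ZMod q) B) := by
  classical
  have h1 : ∀ B : Finset (Fin m → ℤ), (q : ℤ) ^ (m - normalRank (ZMod q) B) =
      ∑ x : Fin m → ZMod q, if ∀ v ∈ B, ∑ k, (v k : ZMod q) * x k = 0 then 1 else 0 := by
    intro B
    have h2 := Module.card_eq_pow_finrank (K := ZMod q)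
      (V := (⨅ v ∈ B, normalHyperplane (ZMod q) v : Submodule (ZMod q) (Fin m → ZMod q)))
    rw [ZMod.card] at h2
    have h3 : m - normalRank (ZMod q) B = Module.finrank (ZMod q)
        (⨅ v ∈ B, normalHyperplane (ZMod q) v : Submodule (ZMod q) (Fin m → ZMod q)) := by
      have := finrank_iInf_normalHyperplane_add (ZMod q) B
      omega
    rw [h3]
    norm_cast
    rw [← h2, ← card_filter, Fintype.card_subtype]
    congr 1
    ext x
    simp [Submodule.mem_iInf, mem_normalHyperplane]
  simp_rw [h1, mul_sum]
  rw [sum_comm]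
  have h2 : ∀ x : Fin m → ZMod q, ∑ B ∈ (midNormals m).powerset, (-1 : ℤ) ^ #B *
      (if ∀ v ∈ B, ∑ k, (v k : ZMod q) * x k = 0 then 1 else 0)
      = if x ∈ complementPoints q m then 1 else 0 := by
    intro x
    have h3 := sum_powerset_neg_one_pow_card
      (x := (midNormals m).filter fun v => ∑ k, (v k : ZMod q) * x k = 0)
    have h4 : (x ∈ complementPoints q m) ↔
        (midNormals m).filter (fun v => ∑ k, (v k : ZMod q) * x k = 0) = ∅ := by
      simp [complementPoints, filter_eq_empty_iff]
    simp_rw [h4, ← h3, mul_ite, mul_one, mul_zero]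
    rw [← sum_filter]
    refine sum_congr ?_ fun _ _ => rfl
    ext B
    simp only [mem_filter, mem_powerset, subset_iff]
    exact ⟨fun h v hv => ⟨h.1 hv, h.2 v hv⟩, fun h => ⟨fun v hv => (h hv).1, fun v hv => (h hv).2⟩⟩
  simp_rw [h2]
  simp

theorem eval_arrangementCharPoly (hqm : ¬ q ∣ m) (hq : 4 ^ (m - 1) < q ^ 2 * m) :
    (arrangementCharPoly (midHyperplaneArrangement ℝ m)).eval (q : ℤ)
      = #(complementPoints q m) := by
  rw [arrangementCharPoly_eq_sum_normalRank, card_complementPoints, eval_finsetSum]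
  refine sum_congr rfl fun B hB => ?_
  rw [normalRank_zmod_eq hqm hq (mem_powerset.1 hB)]
  simp

end FiniteField

/-! ### From points to mid-free sets, and reduction by affine symmetry. -/

section MidFree

/-- No two disjoint pairs of elements of `S` have the same sum. -/
def IsMidFree {α : Type*} [Add α] (S : Finset α) : Prop :=
  ∀ a ∈ S, ∀ b ∈ S, ∀ c ∈ S, ∀ d ∈ S,
    a ≠ b → a ≠ c → a ≠ d → b ≠ c → b ≠ d → c ≠ d → a + b ≠ c + d

variable (q : ℕ) [Fact q.Prime]

open Classical in
/-- The `k`-element mid-free subsets of `ZMod q`. -/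
noncomputable def midFreeSets (k : ℕ) : Finset (Finset (ZMod q)) :=
  (powersetCard k univ).filter IsMidFree

variable {q} {m : ℕ}

theorem mem_midFreeSets {S : Finset (ZMod q)} : S ∈ midFreeSets q m ↔ #S = m ∧ IsMidFree S := by
  simp [midFreeSets, mem_powersetCard]

theorem mem_complementPoints {x : Fin m → ZMod q} :
    x ∈ complementPoints q m ↔ Function.Injective x ∧ IsMidFree (univ.image x) := by
  have h1 : x ∈ complementPoints q m ↔ (∀ i j, i < j → x i ≠ x j) ∧
      ∀ p r s t, IsMidIndex p r s t → x p + x r ≠ x s + x t := by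
    simp only [complementPoints, mem_filter, mem_univ, true_and]
    constructor
    · refine fun h => ⟨fun i j hij e => h _ (pairNormal_mem hij) ?_,
        fun p r s t hp e => h _ (quadNormal_mem hp) ?_⟩
      · rw [sum_pairNormal_mul, e, sub_self]
      · rw [sum_quadNormal_mul, e]
        ring
    · rintro ⟨h1, h2⟩ v hv
      rcases mem_midNormals.1 hv with ⟨i, j, hij, rfl⟩ | ⟨p, r, s, t, hp, rfl⟩
      · rw [sum_pairNormal_mul, sub_ne_zero]
        exact h1 i j hij
      · rw [sum_quadNormal_mul, sub_sub, sub_ne_zero]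
        exact h2 p r s t hp
  rw [h1]
  constructor
  · rintro ⟨h1, h2⟩
    have hinj : Function.Injective x := by
      intro i j hij
      by_contra hne
      rcases lt_or_gt_of_ne hne with h | h
      · exact h1 i j h hij
      · exact h1 j i h hij.symm
    refine ⟨hinj, ?_⟩
    -- The equation is invariant under exchanging the two pairs and swapping within a pair. The
    -- three order restrictions on the indices are dropped one at a time.
    have h3 : ∀ p r s t : Fin m, p < r → s < t → p ≠ s → p ≠ t → r ≠ s → r ≠ t →
        x p + x r ≠ x s + x t := by
      intro p r s t hpr hst hps hpt hrs hrt
      rcases lt_or_gt_of_ne hps with h | h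
      · exact h2 p r s t ⟨hpr, h, hst, hrs, hrt⟩
      · exact (h2 s t p r ⟨hst, h, hpr, hpt.symm, hrt.symm⟩).symm
    have h4 : ∀ p r s t : Fin m, p < r → p ≠ s → p ≠ t → r ≠ s → r ≠ t → s ≠ t →
        x p + x r ≠ x s + x t := by
      intro p r s t hpr hps hpt hrs hrt hst
      rcases lt_or_gt_of_ne hst with h | h
      · exact h3 p r s t hpr h hps hpt hrs hrt
      · rw [add_comm (x s)]
        exact h3 p r t s hpr h hpt hps hrt hrs
    have h5 : ∀ p r s t : Fin m, p ≠ r → p ≠ s → p ≠ t → r ≠ s → r ≠ t → s ≠ t →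
        x p + x r ≠ x s + x t := by
      intro p r s t hpr hps hpt hrs hrt hst
      rcases lt_or_gt_of_ne hpr with h | h
      · exact h4 p r s t h hps hpt hrs hrt hst
      · rw [add_comm (x p)]
        exact h4 r p s t h hrs hrt hps hpt hst
    intro a ha b hb c hc d hd hab hac had hbc hbd hcd
    simp only [mem_image, mem_univ, true_and] at ha hb hc hd
    obtain ⟨p, rfl⟩ := ha
    obtain ⟨r, rfl⟩ := hb
    obtain ⟨s, rfl⟩ := hc
    obtain ⟨t, rfl⟩ := hd
    exact h5 p r s t (ne_of_apply_ne x hab) (ne_of_apply_ne x hac) (ne_of_apply_ne x had)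
      (ne_of_apply_ne x hbc) (ne_of_apply_ne x hbd) (ne_of_apply_ne x hcd)
  · rintro ⟨hinj, hfree⟩
    refine ⟨fun i j hij => hinj.ne hij.ne, fun p r s t ⟨h1, h2, h3, h4, h5⟩ => ?_⟩
    have hm : ∀ i, x i ∈ univ.image x := fun i => mem_image_of_mem x (mem_univ i)
    exact hfree _ (hm p) _ (hm r) _ (hm s) _ (hm t) (hinj.ne h1.ne) (hinj.ne h2.ne)
      (hinj.ne (h2.trans h3).ne) (hinj.ne h4) (hinj.ne h5) (hinj.ne h3.ne)

theorem injective_of_image_univ_eq {α : Type*} [DecidableEq α] {S : Finset α} (hS : #S = m)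
    {x : Fin m → α} (hx : univ.image x = S) : Function.Injective x := by
  have h : Set.InjOn x (univ : Finset (Fin m)) := card_image_iff.1 (by rw [hx, hS]; simp)
  simpa [Set.injOn_univ] using h

theorem card_filter_image_univ_eq {α : Type*} [Fintype α] [DecidableEq α] {S : Finset α}
    (hS : #S = m) : #{x : Fin m → α | univ.image x = S} = m.factorial := by
  have e : Fin m ≃ S := (Fintype.equivFinOfCardEq (by simpa using hS)).symm
  have h1 : Fintype.card (Fin m ≃ S) = m.factorial := by
    rw [Fintype.card_equiv e, Fintype.card_fin]
  rw [← h1, ← card_univ]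
  symm
  refine card_bij (fun g _ i => (g i : α)) ?_ ?_ ?_
  · intro g _
    simp only [mem_filter, mem_univ, true_and]
    ext a
    simp only [mem_image, mem_univ, true_and]
    constructor
    · rintro ⟨i, rfl⟩
      exact (g i).2
    · intro ha
      exact ⟨g.symm ⟨a, ha⟩, by simp⟩
  · intro g _ g' _ h
    ext i
    exact congrFun h i
  · intro x hx
    have hx' : univ.image x = S := by simpa using hx
    have hmem : ∀ i, x i ∈ S := fun i => hx' ▸ mem_image_of_mem x (mem_univ i)
    have hinj : Function.Injective x := injective_of_image_univ_eq hS hx'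
    have hbij : Function.Bijective fun i => (⟨x i, hmem i⟩ : S) := by
      rw [Fintype.bijective_iff_injective_and_card]
      refine ⟨fun i j h => hinj (congrArg Subtype.val h), ?_⟩
      simp [hS]
    exact ⟨Equiv.ofBijective _ hbij, mem_univ _, rfl⟩

theorem card_complementPoints_eq_factorial_mul :
    #(complementPoints q m) = m.factorial * #(midFreeSets q m) := by
  rw [card_eq_sum_card_fiberwise (f := fun x => univ.image x) (t := midFreeSets q m)]
  · rw [sum_const_nat (m := m.factorial), mul_comm]
    intro S hS
    rw [mem_midFreeSets] at hS
    rw [← card_filter_image_univ_eq hS.1]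
    congr 1
    ext x
    simp only [mem_filter, mem_univ, true_and, and_iff_right_iff_imp]
    intro hx
    rw [mem_complementPoints, hx]
    exact ⟨injective_of_image_univ_eq hS.1 hx, hS.2⟩
  · intro x hx
    have hx' := mem_complementPoints.1 (mem_coe.1 hx)
    exact mem_coe.2 (mem_midFreeSets.2 ⟨by rw [card_image_of_injective _ hx'.1]; simp, hx'.2⟩)

theorem IsMidFree.image_affine {S : Finset (ZMod q)} (hS : IsMidFree S) {u : ZMod q} (hu : u ≠ 0)
    (t : ZMod q) : IsMidFree (S.image fun z => u * z + t) := by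
  intro a ha b hb c hc d hd hab hac had hbc hbd hcd h
  simp only [mem_image] at ha hb hc hd
  obtain ⟨a, ha, rfl⟩ := ha
  obtain ⟨b, hb, rfl⟩ := hb
  obtain ⟨c, hc, rfl⟩ := hc
  obtain ⟨d, hd, rfl⟩ := hd
  refine hS a ha b hb c hc d hd (by rintro rfl; exact hab rfl) (by rintro rfl; exact hac rfl)
    (by rintro rfl; exact had rfl) (by rintro rfl; exact hbc rfl) (by rintro rfl; exact hbd rfl)
    (by rintro rfl; exact hcd rfl) (mul_left_cancel₀ hu ?_)
  linear_combination h

theorem affine_injective {u : ZMod q} (hu : u ≠ 0) (t : ZMod q) :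
    Function.Injective fun z => u * z + t := fun _ _ h =>
  mul_left_cancel₀ hu (add_right_cancel h)

/-- The affine map `z ↦ u * z + t` taking `(a, b)` to `(c, d)` preserves mid-freeness and acts
injectively on sets. By symmetry the two counts are in fact equal. -/
theorem card_midFreeSets_pair_le {a b c d : ZMod q} (hab : a ≠ b) (hcd : c ≠ d) :
    #{S ∈ midFreeSets q m | a ∈ S ∧ b ∈ S} ≤ #{S ∈ midFreeSets q m | c ∈ S ∧ d ∈ S} := by
  have hba : b - a ≠ 0 := sub_ne_zero.2 hab.symm
  set u := (d - c) / (b - a) with hu'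
  have hu : u ≠ 0 := div_ne_zero (sub_ne_zero.2 hcd.symm) hba
  have hub : u * (b - a) = d - c := div_mul_cancel₀ _ hba
  refine card_le_card_of_injOn (fun S => S.image fun z => u * z + (c - u * a)) ?_
    (Finset.image_injective (affine_injective hu _)).injOn
  intro S hS
  simp only [coe_filter, Set.mem_ofPred_eq, mem_midFreeSets] at hS ⊢
  refine ⟨⟨by rw [card_image_of_injective _ (affine_injective hu _), hS.1.1],
    hS.1.2.image_affine hu _⟩, mem_image.2 ⟨a, hS.2.1, by ring⟩, mem_image.2 ⟨b, hS.2.2, ?_⟩⟩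
  linear_combination hub

/-- Double count of mid-free sets with an ordered pair of distinct elements; every pair lies in as
many sets as `(0, 1)`. -/
theorem card_midFreeSets_mul :
    (m * m - m) * #(midFreeSets q m)
      = (q * q - q) * #{S ∈ midFreeSets q m | 0 ∈ S ∧ 1 ∈ S} := by
  have h := sum_card_bipartiteAbove_eq_sum_card_bipartiteBelow (s := midFreeSets q m)
    (t := (univ : Finset (ZMod q)).offDiag) fun S p => p.1 ∈ S ∧ p.2 ∈ S
  rw [sum_const_nat (m := m * m - m), sum_const_nat
    (m := #{S ∈ midFreeSets q m | 0 ∈ S ∧ 1 ∈ S}), offDiag_card, card_univ, ZMod.card, mul_comm] at h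
  · exact h
  · intro p hp
    have hp' : p.1 ≠ p.2 := (mem_offDiag.1 hp).2.2
    exact le_antisymm (card_midFreeSets_pair_le hp' zero_ne_one)
      (card_midFreeSets_pair_le zero_ne_one hp')
  · intro S hS
    rw [← (mem_midFreeSets.1 hS).1, ← offDiag_card]
    congr 1
    ext p
    simp only [bipartiteAbove, mem_filter, mem_offDiag, mem_univ, true_and]
    tauto

end MidFree

/-! ### A bit-mask search counting mid-free sets, and its correctness. -/

section Search

/-- Cyclic shift by `x` of a set of residues modulo `q`, given as a bit mask. -/
def rotateMask (q x A : ℕ) : ℕ :=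
  Nat.mod (Nat.lor (Nat.shiftLeft A x) (Nat.shiftRight A (Nat.sub q x))) (Nat.pow 2 q)

/-- The number of ways to extend a mid-free set of residues below `x` modulo `q` by `k` of the
residues `x, …, x + n - 1`. The masks `F`, `D`, `P`, `S`, `R` hold the forbidden residues, the
differences, the sums, the elements and the negatives of the elements of the given set. -/
noncomputable def countExtensions (q n : ℕ) : ℕ → ℕ → ℕ → ℕ → ℕ → ℕ → ℕ → ℕ :=
  Nat.rec (fun k _ _ _ _ _ _ => Nat.rec 1 (fun _ _ => 0) k)
    (fun _ ih k x F D P S R =>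
      Nat.rec 1 (fun k _ =>
        Nat.add (ih (Nat.succ k) (Nat.succ x) F D P S R)
          -- Branch on bit `x` of `F`: if it is 0, the residue `x` may be added; if it is 1, this
          -- branch contributes nothing. Bare recursors and `Nat` operations keep the count directly
          -- computable by `decide +kernel`.
          (Nat.rec (ih k (Nat.succ x)
              (Nat.lor (Nat.lor (Nat.lor F (Nat.pow 2 x)) (rotateMask q x D))
                (rotateMask q (Nat.sub q x) P))
              (Nat.lor (Nat.lor D (rotateMask q x R)) (rotateMask q (Nat.sub q x) S))
              (Nat.lor P (rotateMask q x S))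
              (Nat.lor S (Nat.pow 2 x))
              (Nat.lor R (Nat.pow 2 (Nat.sub q x))))
            (fun _ _ => 0) (Nat.land (Nat.shiftRight F x) 1))) k) n

theorem countExtensions_zero_right (q n x F D P S R : ℕ) :
    countExtensions q n 0 x F D P S R = 1 := by
  cases n <;> rfl

theorem countExtensions_zero_succ (q k x F D P S R : ℕ) :
    countExtensions q 0 (k + 1) x F D P S R = 0 := rfl

theorem countExtensions_of_testBit {q n k x F D P S R : ℕ} (h : F.testBit x = true) :
    countExtensions q (n + 1) (k + 1) x F D P S R
      = countExtensions q n (k + 1) (x + 1) F D P S R := by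
  have h1 : Nat.land (Nat.shiftRight F x) 1 = 1 := by
    change (F >>> x) &&& 1 = 1
    rw [Nat.testBit, Nat.land_comm] at h
    have := Nat.and_one_is_mod (F >>> x)
    simp at h
    omega
  change Nat.add _ (Nat.rec _ _ (Nat.land (Nat.shiftRight F x) 1)) = _
  rw [h1]
  rfl

theorem countExtensions_of_not_testBit {q n k x F D P S R : ℕ} (h : F.testBit x = false) :
    countExtensions q (n + 1) (k + 1) x F D P S R
      = countExtensions q n (k + 1) (x + 1) F D P S R +
        countExtensions q n k (x + 1) (F ||| 2 ^ x ||| rotateMask q x D ||| rotateMask q (q - x) P)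
          (D ||| rotateMask q x R ||| rotateMask q (q - x) S) (P ||| rotateMask q x S)
          (S ||| 2 ^ x) (R ||| 2 ^ (q - x)) := by
  have h1 : Nat.land (Nat.shiftRight F x) 1 = 0 := by
    change (F >>> x) &&& 1 = 0
    rw [Nat.testBit, Nat.land_comm] at h
    have := Nat.and_one_is_mod (F >>> x)
    simp at h
    omega
  change Nat.add _ (Nat.rec _ _ (Nat.land (Nat.shiftRight F x) 1)) = _
  rw [h1]
  rfl

variable {q : ℕ}

/-- `A` is the bit mask of a set of residues modulo `q`. -/
def IsMask (A : ℕ) (p : ZMod q → Prop) : Prop :=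
  A < 2 ^ q ∧ ∀ z, A.testBit z.val = true ↔ p z

theorem IsMask.or {A B : ℕ} {p r : ZMod q → Prop} (hA : IsMask A p) (hB : IsMask B r) :
    IsMask (A ||| B) fun z => p z ∨ r z :=
  ⟨Nat.or_lt_two_pow hA.1 hB.1, fun z => by simp [hA.2, hB.2]⟩

theorem IsMask.congr {A : ℕ} {p r : ZMod q → Prop} (hA : IsMask A p) (h : ∀ z, p z ↔ r z) :
    IsMask A r :=
  ⟨hA.1, fun z => (hA.2 z).trans (h z)⟩

variable [Fact q.Prime]

theorem isMask_two_pow {x : ℕ} (hx : x < q) : IsMask (2 ^ x) fun z : ZMod q => z = x := by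
  refine ⟨Nat.pow_lt_pow_right (by norm_num) hx, fun z => ?_⟩
  rw [Nat.testBit_two_pow, decide_eq_true_iff]
  constructor
  · rintro rfl
    simp
  · rintro rfl
    rw [ZMod.val_natCast_of_lt hx]

/-- Bits at positions `z ≥ x` come from the left shift and those below `x` from the right shift. The
bound `A < 2 ^ q` keeps the right shift from adding stray bits at positions `z ≥ x`. -/
theorem IsMask.rotate {A x : ℕ} {p : ZMod q → Prop} (hA : IsMask A p) (hx : x < q) :
    IsMask (rotateMask q x A) fun z : ZMod q => p (z - x) := by
  refine ⟨Nat.mod_lt _ (Nat.two_pow_pos q), fun z => ?_⟩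
  change _ ↔ p (z - x)
  rw [← hA.2]
  have hz : z.val < q := ZMod.val_lt z
  change (((A <<< x) ||| (A >>> (q - x))) % 2 ^ q).testBit z.val = true ↔ _
  rw [Nat.testBit_mod_two_pow, Nat.testBit_or, Nat.testBit_shiftLeft, Nat.testBit_shiftRight]
  have hxv : ((x : ℕ) : ZMod q).val = x := ZMod.val_natCast_of_lt hx
  by_cases hle : x ≤ z.val
  · have h1 : (z - (x : ZMod q)).val = z.val - x := by
      rw [ZMod.val_sub (by rwa [hxv]), hxv]
    have h2 : A.testBit (q - x + z.val) = false :=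
      Nat.testBit_lt_two_pow (hA.1.trans_le (Nat.pow_le_pow_right (by norm_num) (by omega)))
    simp [h1, h2, hle, hz]
  · have h1 : (z - (x : ZMod q)).val = q - x + z.val := by
      have h3 : z - (x : ZMod q) = ((q - x + z.val : ℕ) : ZMod q) := by
        push_cast [Nat.cast_sub hx.le]
        simp
        ring
      rw [h3, ZMod.val_natCast_of_lt (by omega)]
    simp [h1, hle, hz]

/-- The bit masks attached to a set of residues by `countExtensions`. -/
structure IsSearchState (T : Finset (ZMod q)) (F D P S R : ℕ) : Prop where
  forbidden : IsMask F fun z : ZMod q => z ∈ T ∨ ∃ a ∈ T, ∃ b ∈ T, ∃ c ∈ T,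
    a ≠ b ∧ a ≠ c ∧ b ≠ c ∧ z + a = b + c
  diffs : IsMask D fun z : ZMod q => ∃ a ∈ T, ∃ b ∈ T, a ≠ b ∧ z + a = b
  sums : IsMask P fun z : ZMod q => ∃ a ∈ T, ∃ b ∈ T, a ≠ b ∧ z = a + b
  elems : IsMask S fun z : ZMod q => z ∈ T
  negs : IsMask R fun z : ZMod q => -z ∈ T

/-- In a new relation `z + a = b + c` the element `x` occurs exactly once among `a, b, c`. If `a =
x`, then `z` is a sum shifted by `-x`; if `b` or `c` is `x`, then `z` is a difference shifted by
`x`. The new differences `x - a` and `a - x` come from shifting the negatives and the elements.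
Positivity of `x` makes `q - x` a legitimate residue. -/
theorem IsSearchState.insert {T : Finset (ZMod q)} {F D P S R x : ℕ}
    (h : IsSearchState T F D P S R) (hx0 : 0 < x) (hx : x < q) (hxT : (x : ZMod q) ∉ T) :
    IsSearchState (insert (x : ZMod q) T)
      (F ||| 2 ^ x ||| rotateMask q x D ||| rotateMask q (q - x) P)
      (D ||| rotateMask q x R ||| rotateMask q (q - x) S) (P ||| rotateMask q x S)
      (S ||| 2 ^ x) (R ||| 2 ^ (q - x)) := by
  have hqx : q - x < q := by omega
  have hcast : ((q - x : ℕ) : ZMod q) = -x := by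
    rw [Nat.cast_sub hx.le]
    simp
  constructor
  · refine (((h.forbidden.or (isMask_two_pow hx)).or (h.diffs.rotate hx)).or
      (h.sums.rotate hqx)).congr fun z => ?_
    rw [hcast]
    generalize (x : ZMod q) = y at hxT
    constructor
    · rintro ((((hz | ⟨a, ha, b, hb, c, hc, h1, h2, h3, e⟩) | rfl) | ⟨a, ha, b, hb, hab, e⟩) |
        ⟨a, ha, b, hb, hab, e⟩)
      · exact Or.inl (mem_insert_of_mem hz)
      · exact Or.inr ⟨a, mem_insert_of_mem ha, b, mem_insert_of_mem hb, c, mem_insert_of_mem hc,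
          h1, h2, h3, e⟩
      · exact Or.inl (mem_insert_self _ _)
      · exact Or.inr ⟨a, mem_insert_of_mem ha, y, mem_insert_self _ _, b, mem_insert_of_mem hb,
          ne_of_mem_of_not_mem ha hxT, hab, (ne_of_mem_of_not_mem hb hxT).symm,
          by linear_combination e⟩
      · exact Or.inr ⟨y, mem_insert_self _ _, a, mem_insert_of_mem ha, b, mem_insert_of_mem hb,
          (ne_of_mem_of_not_mem ha hxT).symm, (ne_of_mem_of_not_mem hb hxT).symm, hab,
          by linear_combination e⟩
    · simp only [mem_insert]
      rintro ((rfl | hz) | ⟨a, rfl | ha, b, rfl | hb, c, rfl | hc, h1, h2, h3, e⟩)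
      · tauto
      · tauto
      · exact absurd rfl h1
      · exact absurd rfl h1
      · exact absurd rfl h2
      · exact Or.inr ⟨b, hb, c, hc, h3, by linear_combination e⟩
      · exact absurd rfl h3
      · exact Or.inl (Or.inr ⟨a, ha, c, hc, h2, by linear_combination e⟩)
      · exact Or.inl (Or.inr ⟨a, ha, b, hb, h1, by linear_combination e⟩)
      · exact Or.inl (Or.inl (Or.inl (Or.inr ⟨a, ha, b, hb, c, hc, h1, h2, h3, e⟩)))
  · refine ((h.diffs.or (h.negs.rotate hx)).or (h.elems.rotate hqx)).congr fun z => ?_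
    rw [hcast]
    generalize (x : ZMod q) = y at hxT
    constructor
    · rintro ((⟨a, ha, b, hb, hab, e⟩ | hz) | hz)
      · exact ⟨a, mem_insert_of_mem ha, b, mem_insert_of_mem hb, hab, e⟩
      · exact ⟨_, mem_insert_of_mem hz, y, mem_insert_self _ _, ne_of_mem_of_not_mem hz hxT,
          by ring⟩
      · exact ⟨y, mem_insert_self _ _, _, mem_insert_of_mem hz,
          (ne_of_mem_of_not_mem hz hxT).symm, by ring⟩
    · simp only [mem_insert]
      rintro ⟨a, rfl | ha, b, rfl | hb, h1, e⟩
      · exact absurd rfl h1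
      · have : z - -a = b := by linear_combination e
        exact Or.inr (this ▸ hb)
      · have : -(z - b) = a := by linear_combination -e
        exact Or.inl (Or.inr (this ▸ ha))
      · exact Or.inl (Or.inl ⟨a, ha, b, hb, h1, e⟩)
  · refine (h.sums.or (h.elems.rotate hx)).congr fun z => ?_
    generalize (x : ZMod q) = y at hxT
    constructor
    · rintro (⟨a, ha, b, hb, hab, e⟩ | hz)
      · exact ⟨a, mem_insert_of_mem ha, b, mem_insert_of_mem hb, hab, e⟩
      · exact ⟨_, mem_insert_of_mem hz, y, mem_insert_self _ _, ne_of_mem_of_not_mem hz hxT,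
          by ring⟩
    · simp only [mem_insert]
      rintro ⟨a, rfl | ha, b, rfl | hb, h1, e⟩
      · exact absurd rfl h1
      · have : z - a = b := by linear_combination e
        exact Or.inr (this ▸ hb)
      · have : z - b = a := by linear_combination e
        exact Or.inr (this ▸ ha)
      · exact Or.inl ⟨a, ha, b, hb, h1, e⟩
  · refine (h.elems.or (isMask_two_pow hx)).congr fun z => ?_
    rw [mem_insert, or_comm]
  · refine (h.negs.or (isMask_two_pow hqx)).congr fun z => ?_
    rw [mem_insert, or_comm, hcast, neg_eq_iff_eq_neg]

theorem isMidFree_insert {T : Finset (ZMod q)} (hT : IsMidFree T) {x : ZMod q}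
    (h : ¬ ∃ a ∈ T, ∃ b ∈ T, ∃ c ∈ T, a ≠ b ∧ a ≠ c ∧ b ≠ c ∧ x + a = b + c) :
    IsMidFree (insert x T) := by
  push Not at h
  intro a ha b hb c hc d hd hab hac had hbc hbd hcd e
  rw [mem_insert] at ha hb hc hd
  rcases ha with rfl | ha
  · exact h b (hb.resolve_left hab.symm) c (hc.resolve_left hac.symm) d
      (hd.resolve_left had.symm) hbc hbd hcd e
  rcases hb with rfl | hb
  · exact h a ha c (hc.resolve_left hbc.symm) d
      (hd.resolve_left hbd.symm) hac had hcd (by rw [add_comm, e])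
  rcases hc with rfl | hc
  · exact h d (hd.resolve_left hcd.symm) a ha b hb had.symm hbd.symm hab e.symm
  rcases hd with rfl | hd
  · exact h c hc a ha b hb hac.symm hbc.symm hab (by rw [add_comm, e])
  exact hT a ha b hb c hc d hd hab hac had hbc hbd hcd e

open Classical in
/-- The sets of `k` residues from `x` on that extend `T` to a mid-free set. -/
noncomputable def midFreeExtensions (T : Finset (ZMod q)) (x k : ℕ) : Finset (Finset (ZMod q)) :=
  univ.filter fun U => (∀ z ∈ U, x ≤ z.val) ∧ #U = k ∧ IsMidFree (T ∪ U)

theorem mem_midFreeExtensions {T U : Finset (ZMod q)} {x k : ℕ} :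
    U ∈ midFreeExtensions T x k ↔ (∀ z ∈ U, x ≤ z.val) ∧ #U = k ∧ IsMidFree (T ∪ U) := by
  simp [midFreeExtensions]

/-- Induction on the number of residues left, splitting extensions by whether they contain `x`. As
`x` is not in `T`, a set bit of `F` at `x` means that adding `x` violates mid-freeness, and an unset
bit that `T` with `x` added is again mid-free. -/
theorem countExtensions_eq_card {n : ℕ} :
    ∀ {k x F D P S R : ℕ} {T : Finset (ZMod q)}, 0 < x → x + n = q → (∀ z ∈ T, z.val < x) →
      IsMidFree T → IsSearchState T F D P S R →
      countExtensions q n k x F D P S R = #(midFreeExtensions T x k) := by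
  have hzero : ∀ {x : ℕ} {T : Finset (ZMod q)}, IsMidFree T →
      midFreeExtensions T x 0 = {∅} := by
    intro x T hT
    ext U
    rw [mem_midFreeExtensions, card_eq_zero, mem_singleton]
    refine ⟨fun h => h.2.1, ?_⟩
    rintro rfl
    simpa using hT
  induction n with
  | zero =>
    intro k x F D P S R T hx hxq hTx hT hs
    cases k with
    | zero => rw [hzero hT, countExtensions_zero_right]; rfl
    | succ k =>
      rw [countExtensions_zero_succ, eq_comm, card_eq_zero, eq_empty_iff_forall_notMem]
      intro U hU
      obtain ⟨h1, h2, -⟩ := mem_midFreeExtensions.1 hU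
      obtain ⟨z, hz⟩ := card_pos.1 (by omega : 0 < #U)
      have := h1 z hz
      have := ZMod.val_lt z
      omega
  | succ n ih =>
    intro k x F D P S R T hx hxq hTx hT hs
    cases k with
    | zero => rw [hzero hT, countExtensions_zero_right]; rfl
    | succ k =>
      have hxlt : x < q := by omega
      have hxval : ((x : ℕ) : ZMod q).val = x := ZMod.val_natCast_of_lt hxlt
      have hxT : (x : ZMod q) ∉ T := fun h => by
        have := hTx _ h
        omega
      have hsplit := card_filter_add_card_filter_not (s := midFreeExtensions T x (k + 1))
        fun U => (x : ZMod q) ∉ U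
      have hle : ∀ {U : Finset (ZMod q)}, (∀ z ∈ U, x ≤ z.val) → (x : ZMod q) ∉ U →
          ∀ z ∈ U, x + 1 ≤ z.val := by
        intro U hU hxU z hz
        refine lt_of_le_of_ne (hU z hz) ?_
        rintro h
        exact hxU (by rw [h]; simpa using hz)
      have h1 : (midFreeExtensions T x (k + 1)).filter (fun U => (x : ZMod q) ∉ U)
          = midFreeExtensions T (x + 1) (k + 1) := by
        ext U
        simp only [mem_filter, mem_midFreeExtensions]
        constructor
        · rintro ⟨⟨h1, h2⟩, h3⟩
          exact ⟨hle h1 h3, h2⟩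
        · rintro ⟨h1, h2⟩
          refine ⟨⟨fun z hz => (Nat.le_succ x).trans (h1 z hz), h2⟩, fun h => ?_⟩
          have := h1 _ h
          omega
      rw [h1, ← ih (Nat.succ_pos x) (by omega) (fun z hz => (hTx z hz).trans (Nat.lt_succ_self x))
        hT hs] at hsplit
      cases hF : F.testBit x with
      | true =>
        rw [countExtensions_of_testBit hF, ← hsplit, Nat.left_eq_add, card_eq_zero,
          filter_eq_empty_iff]
        intro U hU hxU
        rw [not_not] at hxU
        obtain ⟨-, -, h3⟩ := mem_midFreeExtensions.1 hU
        have h4 := (hs.forbidden.2 x).1 (by rwa [hxval])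
        obtain ⟨a, ha, b, hb, c, hc, hab, hac, hbc, e⟩ := h4.resolve_left hxT
        have hne : ∀ {y}, y ∈ T → (x : ZMod q) ≠ y := fun hy h => hxT (h ▸ hy)
        exact h3 x (mem_union_right _ hxU) a (mem_union_left _ ha) b (mem_union_left _ hb)
          c (mem_union_left _ hc) (hne ha) (hne hb) (hne hc) hab hac hbc e
      | false =>
        rw [countExtensions_of_not_testBit hF, ← hsplit]
        have hnF := mt (hs.forbidden.2 x).2 (by simp [hxval, hF])
        have hT' : IsMidFree (insert (x : ZMod q) T) :=
          isMidFree_insert hT fun h => hnF (Or.inr h)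
        rw [ih (Nat.succ_pos x) (by omega) ?_ hT' (hs.insert hx hxlt hxT)]
        · congr 1
          symm
          refine card_nbij' (fun U => U.erase (x : ZMod q)) (fun U => insert (x : ZMod q) U)
            ?_ ?_ ?_ ?_
          · intro U hU
            simp only [coe_filter, Set.mem_ofPred_eq, not_not, mem_midFreeExtensions] at hU
            obtain ⟨⟨h1, h2, h3⟩, hxU⟩ := hU
            refine mem_coe.2 (mem_midFreeExtensions.2 ⟨hle (fun z hz => h1 z (mem_erase.1 hz).2)
              (notMem_erase _ _), by rw [card_erase_of_mem hxU, h2]; rfl, ?_⟩)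
            rwa [insert_union, ← union_insert, insert_erase hxU]
          · intro U hU
            obtain ⟨h1, h2, h3⟩ := mem_midFreeExtensions.1 (mem_coe.1 hU)
            have hxU : (x : ZMod q) ∉ U := fun h => by
              have := h1 _ h
              omega
            simp only [coe_filter, Set.mem_ofPred_eq, not_not, mem_midFreeExtensions]
            refine ⟨⟨?_, by rw [card_insert_of_notMem hxU, h2], ?_⟩, mem_insert_self _ _⟩
            · intro z hz
              rcases mem_insert.1 hz with rfl | hz
              · rw [hxval]
              · exact (Nat.le_succ x).trans (h1 z hz)
            · rwa [union_insert, ← insert_union]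
          · intro U hU
            simp only [coe_filter, Set.mem_ofPred_eq, not_not] at hU
            exact insert_erase hU.2
          · intro U hU
            obtain ⟨h1, h2, h3⟩ := mem_midFreeExtensions.1 (mem_coe.1 hU)
            refine erase_insert fun h => ?_
            have := h1 _ h
            omega
        · intro z hz
          rcases mem_insert.1 hz with rfl | hz
          · rw [hxval]
            exact Nat.lt_succ_self x
          · exact (hTx z hz).trans (Nat.lt_succ_self x)

/-- The only differences are 1 and -1 and the only sum is 1. With two elements there are no three
distinct ones, so only 0 and 1 themselves are forbidden. -/
theorem isSearchState_zero_one (hq : 2 < q) :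
    IsSearchState ({0, 1} : Finset (ZMod q)) (1 ||| 2) (2 ||| 2 ^ (q - 1)) 2 (1 ||| 2)
      (1 ||| 2 ^ (q - 1)) := by
  have h0 : IsMask 1 fun z : ZMod q => z = 0 := by
    simpa using isMask_two_pow (q := q) (x := 0) (by omega)
  have h1 : IsMask 2 fun z : ZMod q => z = 1 := by
    simpa using isMask_two_pow (q := q) (x := 1) (by omega)
  have h2 : IsMask (2 ^ (q - 1)) fun z : ZMod q => z = -1 := by
    have := isMask_two_pow (q := q) (x := q - 1) (by omega)
    rw [Nat.cast_sub (by omega)] at this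
    simpa using this
  constructor
  · refine (h0.or h1).congr fun z => ?_
    simp only [mem_insert, mem_singleton]
    refine ⟨Or.inl, ?_⟩
    rintro (hz | ⟨a, ha, b, hb, c, hc, hab, hac, hbc, -⟩)
    · exact hz
    · rcases ha with rfl | rfl <;> rcases hb with rfl | rfl <;> rcases hc with rfl | rfl <;>
        simp_all
  · refine (h1.or h2).congr fun z => ?_
    simp only [mem_insert, mem_singleton]
    constructor
    · rintro (rfl | rfl)
      · exact ⟨0, Or.inl rfl, 1, Or.inr rfl, zero_ne_one, add_zero 1⟩
      · exact ⟨1, Or.inr rfl, 0, Or.inl rfl, one_ne_zero, neg_add_cancel 1⟩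
    · rintro ⟨a, rfl | rfl, b, rfl | rfl, hab, e⟩
      · exact absurd rfl hab
      · exact Or.inl (by simpa using e)
      · exact Or.inr (eq_neg_of_add_eq_zero_left e)
      · exact absurd rfl hab
  · refine h1.congr fun z => ?_
    simp only [mem_insert, mem_singleton]
    constructor
    · rintro rfl
      exact ⟨0, Or.inl rfl, 1, Or.inr rfl, zero_ne_one, (zero_add 1).symm⟩
    · rintro ⟨a, rfl | rfl, b, rfl | rfl, hab, e⟩
      · exact absurd rfl hab
      · simpa using e
      · simpa using e
      · exact absurd rfl hab
  · refine (h0.or h1).congr fun z => ?_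
    simp
  · refine (h0.or h2).congr fun z => ?_
    simp [neg_eq_iff_eq_neg]

theorem card_midFreeSets_zero_one (hq : 2 < q) (k : ℕ) :
    #{S ∈ midFreeSets q (k + 2) | 0 ∈ S ∧ 1 ∈ S}
      = countExtensions q (q - 2) k 2 (1 ||| 2) (2 ||| 2 ^ (q - 1)) 2 (1 ||| 2)
        (1 ||| 2 ^ (q - 1)) := by
  have hval1 : (1 : ZMod q).val = 1 := ZMod.val_one'' (by omega)
  have hfree : IsMidFree ({0, 1} : Finset (ZMod q)) := by
    intro a ha b hb c hc d hd hab hac had hbc hbd hcd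
    simp only [mem_insert, mem_singleton] at ha hb hc
    rcases ha with rfl | rfl <;> rcases hb with rfl | rfl <;> rcases hc with rfl | rfl <;>
      simp_all
  have hT : ∀ z ∈ ({0, 1} : Finset (ZMod q)), z.val < 2 := by
    simp [hval1]
  rw [countExtensions_eq_card (T := ({0, 1} : Finset (ZMod q))) (by norm_num) (by omega) hT hfree
    (isSearchState_zero_one hq)]
  have hcard : #({0, 1} : Finset (ZMod q)) = 2 := card_pair zero_ne_one
  refine card_nbij' (fun S => S \ {0, 1}) (fun U => {0, 1} ∪ U) ?_ ?_ ?_ ?_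
  · intro S hS
    simp only [coe_filter, Set.mem_ofPred_eq, mem_midFreeSets] at hS
    obtain ⟨⟨h1, h2⟩, h3, h4⟩ := hS
    have hsub : {0, 1} ⊆ S := by simp [insert_subset_iff, h3, h4]
    refine mem_coe.2 (mem_midFreeExtensions.2 ⟨?_, ?_, ?_⟩)
    · intro z hz
      rw [mem_sdiff, mem_insert, mem_singleton, not_or] at hz
      by_contra hlt
      have : z.val = 0 ∨ z.val = 1 := by omega
      rcases this with h | h
      · exact hz.2.1 ((ZMod.val_eq_zero z).1 h)
      · exact hz.2.2 (ZMod.val_injective q (h.trans hval1.symm))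
    · rw [card_sdiff_of_subset hsub, h1, hcard]
      rfl
    · rwa [union_sdiff_of_subset hsub]
  · intro U hU
    obtain ⟨h1, h2, h3⟩ := mem_midFreeExtensions.1 (mem_coe.1 hU)
    simp only [coe_filter, Set.mem_ofPred_eq, mem_midFreeSets]
    refine ⟨⟨?_, h3⟩, by simp, by simp⟩
    rw [card_union_of_disjoint, hcard, h2, add_comm]
    exact disjoint_left.2 fun z hz hzU => absurd (hT z hz) (not_lt.2 (h1 z hzU))
  · intro S hS
    simp only [coe_filter, Set.mem_ofPred_eq, mem_midFreeSets] at hS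
    exact union_sdiff_of_subset (by simp [insert_subset_iff, hS.2.1, hS.2.2])
  · intro U hU
    obtain ⟨h1, h2, h3⟩ := mem_midFreeExtensions.1 (mem_coe.1 hU)
    refine union_sdiff_cancel_left ?_
    exact disjoint_left.2 fun z hz hzU => absurd (hT z hz) (not_lt.2 (h1 z hzU))

/-- The mid-hyperplane characteristic polynomial at a prime of good reduction. -/
theorem eval_arrangementCharPoly_eq_countExtensions (hq2 : 2 < q) {k : ℕ} (hqm : ¬ q ∣ k + 2)
    (hq : 4 ^ (k + 1) < q ^ 2 * (k + 2)) :
    (arrangementCharPoly (midHyperplaneArrangement ℝ (k + 2))).eval (q : ℤ)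
      = k.factorial * (q * (q - 1)) * countExtensions q (q - 2) k 2 (1 ||| 2)
        (2 ||| 2 ^ (q - 1)) 2 (1 ||| 2) (1 ||| 2 ^ (q - 1)) := by
  rw [eval_arrangementCharPoly q hqm hq, card_complementPoints_eq_factorial_mul,
    ← card_midFreeSets_zero_one hq2]
  have h := card_midFreeSets_mul (q := q) (m := k + 2)
  have h1 : (k + 2) * (k + 2) - (k + 2) = (k + 2) * (k + 1) := by
    rw [Nat.sub_eq_iff_eq_add (by nlinarith)]
    ring
  have h2 : q * q - q = q * (q - 1) := by rw [Nat.mul_sub, mul_one]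
  rw [h1, h2] at h
  -- The factor `(k + 2) * (k + 1)` of the factorial is the number of ordered pairs in the double
  -- count.
  have h3 : (k + 2).factorial * #(midFreeSets q (k + 2)) = k.factorial * (q * (q - 1)) *
      #{S ∈ midFreeSets q (k + 2) | 0 ∈ S ∧ 1 ∈ S} := by
    rw [mul_assoc, ← h, Nat.factorial_succ, Nat.factorial_succ]
    ring
  rw [h3]
  push_cast [Nat.cast_sub (by omega : 1 ≤ q)]
  rfl

end Search

/-! ### Leading coefficients and the roots 0 and 1. -/

section Coefficients

variable {m : ℕ} {B C : Finset (Fin m → ℤ)}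

theorem normalRank_mono (F : Type*) [Field F] (h : B ⊆ C) : normalRank F B ≤ normalRank F C :=
  Submodule.finrank_mono (Submodule.span_mono (Set.image_mono (by exact_mod_cast h)))

theorem card_le_normalRank {F : Type*} [Field F]
    (h : LinearIndepOn F (castVec F) (B : Set (Fin m → ℤ))) : #B ≤ normalRank F B := by
  have h1 := finrank_span_eq_card (LinearIndepOn.linearIndependent h)
  rw [← Set.image_eq_range] at h1
  rw [normalRank, h1]
  simp

theorem normalRank_le_card (F : Type*) [Field F] : normalRank F B ≤ #B := by
  classical
  rw [normalRank, ← coe_image]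
  exact (finrank_span_finset_le_card _).trans card_image_le

/-- The all-ones vector lies on every hyperplane, so no intersection is zero. -/
theorem normalRank_lt (hm : 0 < m) (hB : B ⊆ midNormals m) : normalRank ℝ B < m := by
  have h := finrank_iInf_normalHyperplane_add ℝ B
  have hpos : 0 < Module.finrank ℝ
      (⨅ v ∈ B, normalHyperplane ℝ v : Submodule ℝ (Fin m → ℝ)) := by
    rw [Module.finrank_pos_iff]
    refine ⟨⟨⟨1, ?_⟩, 0, fun h1 => ?_⟩⟩
    · simp only [Submodule.mem_iInf, mem_normalHyperplane]
      intro v hv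
      have := sum_eq_zero_of_mem_midNormals (hB hv)
      simp only [Pi.one_apply, mul_one]
      exact_mod_cast this
    · have := congrFun (congrArg Subtype.val h1) ⟨0, hm⟩
      simp at this
  omega

theorem normalRank_pair {v w : Fin m → ℤ} (hv : v ∈ midNormals m) (hw : w ∈ midNormals m)
    (hvw : v ≠ w) : normalRank ℝ {v, w} = 2 := by
  have hcard : #{v, w} = 2 := card_pair hvw
  refine le_antisymm (hcard ▸ normalRank_le_card ℝ) ?_
  rw [← hcard]
  refine card_le_normalRank ?_
  rw [coe_pair, LinearIndepOn.pair_iff _ hvw]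
  intro c d h
  have h1 : ∀ k, c * (v k : ℝ) = -d * (w k : ℝ) := by
    intro k
    have := congrFun h k
    simp only [castVec, Pi.add_apply, Pi.smul_apply, smul_eq_mul, Pi.zero_apply] at this
    linear_combination this
  have := eq_zero_of_smul_eq_smul hv hw hvw h1
  exact ⟨this.1, by simpa using this.2⟩

theorem two_le_normalRank (hB : B ⊆ midNormals m) (h : 2 ≤ #B) : 2 ≤ normalRank ℝ B := by
  obtain ⟨v, hv, w, hw, hvw⟩ := one_lt_card.1 h
  rw [← normalRank_pair (hB hv) (hB hw) hvw]
  exact normalRank_mono ℝ (by simp [insert_subset_iff, hv, hw])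

theorem normalRank_singleton {v : Fin m → ℤ} (hv : v ∈ midNormals m) :
    normalRank ℝ {v} = 1 := by
  refine le_antisymm (normalRank_le_card ℝ) ((card_singleton v).ge.trans ?_)
  refine card_le_normalRank ?_
  rw [coe_singleton, linearIndepOn_singleton_iff]
  obtain ⟨p, hp, -⟩ := exists_first_eq_one_of_mem_midNormals hv
  intro h
  have := congrFun h p
  simp [castVec, hp] at this

theorem normalRank_eq_zero_iff (hB : B ⊆ midNormals m) : normalRank ℝ B = 0 ↔ #B = 0 := by
  refine ⟨fun h => ?_, fun h => Nat.eq_zero_of_le_zero (h ▸ normalRank_le_card ℝ)⟩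
  by_contra hne
  obtain ⟨v, hv⟩ := card_pos.1 (Nat.pos_of_ne_zero hne)
  have := normalRank_mono ℝ (singleton_subset_iff.2 hv)
  rw [normalRank_singleton (hB hv)] at this
  omega

theorem normalRank_eq_one_iff (hB : B ⊆ midNormals m) : normalRank ℝ B = 1 ↔ #B = 1 := by
  constructor
  · intro h
    have h1 := normalRank_le_card ℝ (B := B)
    by_contra hne
    have := two_le_normalRank hB (by omega)
    omega
  · intro h
    obtain ⟨v, rfl⟩ := card_eq_one.1 h
    exact normalRank_singleton (hB (mem_singleton_self v))

variable (m)

theorem coeff_arrangementCharPoly {r : ℕ} (hr : r ≤ m) :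
    (arrangementCharPoly (midHyperplaneArrangement ℝ m)).coeff (m - r) =
      ∑ B ∈ (midNormals m).powerset with normalRank ℝ B = r, (-1 : ℤ) ^ #B := by
  rw [arrangementCharPoly_eq_sum_normalRank, finsetSum_coeff, sum_filter]
  refine sum_congr rfl fun B _ => ?_
  have h := finrank_iInf_normalHyperplane_add ℝ B
  rw [coeff_C_mul, coeff_X_pow, mul_ite, mul_one, mul_zero]
  refine if_congr ?_ rfl rfl
  omega

theorem sum_normalRank_eq_card {r : ℕ} (h : ∀ B ⊆ midNormals m, normalRank ℝ B = r ↔ #B = r) :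
    ∑ B ∈ (midNormals m).powerset with normalRank ℝ B = r, (-1 : ℤ) ^ #B
      = (-1) ^ r * (#(midNormals m)).choose r := by
  have h1 : (midNormals m).powerset.filter (fun B => normalRank ℝ B = r)
      = powersetCard r (midNormals m) := by
    ext B
    rw [mem_filter, mem_powerset, mem_powersetCard]
    exact and_congr_right fun hB => h B hB
  rw [h1, sum_congr rfl fun B hB => by rw [(mem_powersetCard.1 hB).2], sum_const,
    card_powersetCard, nsmul_eq_mul, mul_comm]

theorem natDegree_arrangementCharPoly_le :
    (arrangementCharPoly (midHyperplaneArrangement ℝ m)).natDegree ≤ m := by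
  rw [arrangementCharPoly_eq_sum_normalRank]
  refine natDegree_sum_le_of_forall_le _ _ fun B _ => ?_
  exact (natDegree_C_mul_X_pow_le _ _).trans (Nat.sub_le _ _)

theorem coeff_arrangementCharPoly_self :
    (arrangementCharPoly (midHyperplaneArrangement ℝ m)).coeff m = 1 := by
  have h := coeff_arrangementCharPoly m (Nat.zero_le m)
  rw [sum_normalRank_eq_card m fun B hB => normalRank_eq_zero_iff hB] at h
  simpa using h

theorem monic_arrangementCharPoly :
    (arrangementCharPoly (midHyperplaneArrangement ℝ m)).Monic :=
  monic_of_natDegree_le_of_coeff_eq_one m (natDegree_arrangementCharPoly_le m)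
    (coeff_arrangementCharPoly_self m)

theorem natDegree_arrangementCharPoly :
    (arrangementCharPoly (midHyperplaneArrangement ℝ m)).natDegree = m :=
  le_antisymm (natDegree_arrangementCharPoly_le m)
    (le_natDegree_of_ne_zero (by rw [coeff_arrangementCharPoly_self]; exact one_ne_zero))

theorem coeff_arrangementCharPoly_sub_one (hm : 1 ≤ m) :
    (arrangementCharPoly (midHyperplaneArrangement ℝ m)).coeff (m - 1) = -#(midNormals m) := by
  rw [coeff_arrangementCharPoly m hm,
    sum_normalRank_eq_card m fun B hB => normalRank_eq_one_iff hB]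
  simp

/-- The signed number of dependent families of hyperplanes that meet in codimension two. -/
noncomputable def dependentRankTwoSum : ℤ :=
  ∑ B ∈ (midNormals m).powerset with normalRank ℝ B = 2 ∧ 3 ≤ #B, (-1 : ℤ) ^ #B

theorem coeff_arrangementCharPoly_sub_two (hm : 2 ≤ m) :
    (arrangementCharPoly (midHyperplaneArrangement ℝ m)).coeff (m - 2)
      = (#(midNormals m)).choose 2 + dependentRankTwoSum m := by
  rw [coeff_arrangementCharPoly m hm, dependentRankTwoSum,
    ← sum_filter_add_sum_filter_not _ fun B => #B = 2, filter_filter, filter_filter]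
  congr 1
  · have h1 : (midNormals m).powerset.filter (fun B => normalRank ℝ B = 2 ∧ #B = 2)
        = powersetCard 2 (midNormals m) := by
      ext B
      rw [mem_filter, mem_powerset, mem_powersetCard]
      refine and_congr_right fun hB => ⟨And.right, fun h => ⟨?_, h⟩⟩
      exact le_antisymm (h ▸ normalRank_le_card ℝ) (two_le_normalRank hB h.ge)
    rw [h1, sum_congr rfl fun B hB => by rw [(mem_powersetCard.1 hB).2], sum_const,
      card_powersetCard]
    simp
  · refine sum_congr (filter_congr fun B _ => and_congr_right fun h => ?_) fun _ _ => rfl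
    have := normalRank_le_card ℝ (B := B)
    omega

theorem eval_zero_arrangementCharPoly (hm : 0 < m) :
    (arrangementCharPoly (midHyperplaneArrangement ℝ m)).eval 0 = 0 := by
  rw [arrangementCharPoly_eq_sum_normalRank, eval_finsetSum]
  refine sum_eq_zero fun B hB => ?_
  have := normalRank_lt hm (mem_powerset.1 hB)
  simp [(Nat.sub_pos_of_lt this).ne']

/-- At `t = 1` the ranks disappear from Whitney's sum, leaving the alternating sum over all subsets
of a nonempty set. -/
theorem eval_one_arrangementCharPoly (hm : 2 ≤ m) :
    (arrangementCharPoly (midHyperplaneArrangement ℝ m)).eval 1 = 0 := by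
  have h := sum_powerset_neg_one_pow_card (x := midNormals m)
  have hne : midNormals m ≠ ∅ :=
    ne_empty_of_mem (pairNormal_mem (i := ⟨0, by omega⟩) (j := ⟨1, by omega⟩) (by simp))
  rw [if_neg hne] at h
  rw [arrangementCharPoly_eq_sum_normalRank, eval_finsetSum, ← h]
  simp

end Coefficients

/-! ### Grouping families by the coordinates they involve. -/

section Transport

variable {k m : ℕ}

/-- An integral vector extended by zero along an embedding of index sets. -/
noncomputable def extendVec (e : Fin k ↪o Fin m) (v : Fin k → ℤ) : Fin m → ℤ :=
  Function.extend e v 0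

@[simp]
theorem extendVec_apply (e : Fin k ↪o Fin m) (v : Fin k → ℤ) (i : Fin k) :
    extendVec e v (e i) = v i :=
  e.injective.extend_apply _ _ _

theorem extendVec_apply_of_notMem (e : Fin k ↪o Fin m) (v : Fin k → ℤ) {i : Fin m}
    (hi : i ∉ Set.range e) : extendVec e v i = 0 :=
  Function.extend_apply' _ _ _ hi

theorem extendVec_injective (e : Fin k ↪o Fin m) : Function.Injective (extendVec e) := by
  intro v w h
  ext i
  simpa using congrFun h (e i)

theorem extendVec_eq_iff (e : Fin k ↪o Fin m) {v : Fin k → ℤ} {w : Fin m → ℤ} :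
    extendVec e v = w ↔ (∀ i, v i = w (e i)) ∧ ∀ i ∉ Set.range e, w i = 0 := by
  constructor
  · rintro rfl
    exact ⟨fun i => by simp, fun i hi => extendVec_apply_of_notMem e v hi⟩
  · rintro ⟨h1, h2⟩
    ext i
    by_cases hi : i ∈ Set.range e
    · obtain ⟨j, rfl⟩ := hi
      rw [extendVec_apply, h1]
    · rw [extendVec_apply_of_notMem e v hi, h2 i hi]

theorem extendVec_pairNormal (e : Fin k ↪o Fin m) (i j : Fin k) :
    extendVec e (pairNormal i j) = pairNormal (e i) (e j) := by
  rw [extendVec_eq_iff]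
  constructor
  · intro l
    simp [pairNormal, Pi.single_apply]
  · intro l hl
    have h : ∀ i, l ≠ e i := fun i h => hl ⟨i, h.symm⟩
    simp [pairNormal, h]

theorem extendVec_quadNormal (e : Fin k ↪o Fin m) (p q r s : Fin k) :
    extendVec e (quadNormal p q r s) = quadNormal (e p) (e q) (e r) (e s) := by
  rw [extendVec_eq_iff]
  constructor
  · intro l
    simp [quadNormal, Pi.single_apply]
  · intro l hl
    have h : ∀ i, l ≠ e i := fun i h => hl ⟨i, h.symm⟩
    simp [quadNormal, h]

theorem mem_midNormals_iff_exists_extendVec (e : Fin k ↪o Fin m) {w : Fin m → ℤ} :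
    (∃ v ∈ midNormals k, extendVec e v = w) ↔
      w ∈ midNormals m ∧ ∀ i, w i ≠ 0 → i ∈ Set.range e := by
  constructor
  · rintro ⟨v, hv, rfl⟩
    refine ⟨?_, fun i hi => ?_⟩
    · rcases mem_midNormals.1 hv with ⟨i, j, hij, rfl⟩ | ⟨p, q, r, s, ⟨h1, h2, h3, h4, h5⟩, rfl⟩
      · rw [extendVec_pairNormal]
        exact pairNormal_mem (e.lt_iff_lt.2 hij)
      · rw [extendVec_quadNormal]
        exact quadNormal_mem ⟨e.lt_iff_lt.2 h1, e.lt_iff_lt.2 h2, e.lt_iff_lt.2 h3,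
          e.injective.ne h4, e.injective.ne h5⟩
    · by_contra h
      exact hi (extendVec_apply_of_notMem e v h)
  · rintro ⟨hw, hs⟩
    rcases mem_midNormals.1 hw with ⟨i, j, hij, rfl⟩ | ⟨p, q, r, s, ⟨h1, h2, h3, h4, h5⟩, rfl⟩
    · obtain ⟨i, rfl⟩ := hs i (by simp [pairNormal, hij.ne])
      obtain ⟨j, rfl⟩ := hs j (by simp [pairNormal, hij.ne'])
      exact ⟨_, pairNormal_mem (e.lt_iff_lt.1 hij), extendVec_pairNormal e i j⟩
    · have hps := h2.trans h3
      obtain ⟨p, rfl⟩ := hs p (by simp [quadNormal, h1.ne, h2.ne, hps.ne])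
      obtain ⟨q, rfl⟩ := hs q (by simp [quadNormal, h1.ne', h4, h5])
      obtain ⟨r, rfl⟩ := hs r (by simp [quadNormal, h2.ne', h4.symm, h3.ne])
      obtain ⟨s, rfl⟩ := hs s (by simp [quadNormal, hps.ne', h5.symm, h3.ne'])
      exact ⟨_, quadNormal_mem ⟨e.lt_iff_lt.1 h1, e.lt_iff_lt.1 h2, e.lt_iff_lt.1 h3,
        ne_of_apply_ne e h4, ne_of_apply_ne e h5⟩, extendVec_quadNormal e p q r s⟩

theorem normalRank_image_extendVec (F : Type*) [Field F] (e : Fin k ↪o Fin m)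
    (B : Finset (Fin k → ℤ)) : normalRank F (B.image (extendVec e)) = normalRank F B := by
  let L := Function.ExtendByZero.linearMap F e
  have hL : Function.Injective L := by
    intro v w h
    ext i
    have := congrFun h (e i)
    simpa [L, e.injective.extend_apply] using this
  have hcomp : ∀ v, castVec F (extendVec e v) = L (castVec F v) := by
    intro v
    ext i
    by_cases hi : i ∈ Set.range e
    · obtain ⟨j, rfl⟩ := hi
      simp [castVec, L, e.injective.extend_apply]
    · have h1 : L (castVec F v) i = 0 := Function.extend_apply' _ _ _ hi
      rw [h1, castVec, extendVec_apply_of_notMem e v hi, Int.cast_zero]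
  have himage : castVec F '' (B.image (extendVec e) : Finset (Fin m → ℤ))
      = L '' (castVec F '' (B : Set (Fin k → ℤ))) := by
    rw [coe_image, Set.image_image, Set.image_image]
    exact Set.image_congr fun v _ => hcomp v
  rw [normalRank, himage, Submodule.span_image]
  exact (Submodule.equivMapOfInjective L hL _).finrank_eq.symm

/-- The coordinates that occur in a finite set of integral vectors. -/
def vecSupport (B : Finset (Fin m → ℤ)) : Finset (Fin m) :=
  univ.filter fun i => ∃ v ∈ B, v i ≠ 0

theorem mem_vecSupport {B : Finset (Fin m → ℤ)} {i : Fin m} :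
    i ∈ vecSupport B ↔ ∃ v ∈ B, v i ≠ 0 := by
  simp [vecSupport]

theorem mem_vecSupport_image_extendVec (e : Fin k ↪o Fin m) {B : Finset (Fin k → ℤ)} {i : Fin m} :
    i ∈ vecSupport (B.image (extendVec e)) ↔ ∃ j ∈ vecSupport B, e j = i := by
  simp only [mem_vecSupport, mem_image, exists_exists_and_eq_and]
  constructor
  · rintro ⟨v, hv, hi⟩
    obtain ⟨j, rfl⟩ : i ∈ Set.range e := by
      by_contra h
      exact hi (extendVec_apply_of_notMem e v h)
    exact ⟨j, ⟨v, hv, by simpa using hi⟩, rfl⟩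
  · rintro ⟨j, ⟨v, hv, hj⟩, rfl⟩
    exact ⟨v, hv, by simpa using hj⟩

theorem sum_range_choose_mul_eq_of_eq_zero {f : ℕ → ℤ} {d : ℕ} (hf : ∀ k, d < k → f k = 0)
    (m : ℕ) :
    ∑ k ∈ range (m + 1), (m.choose k : ℤ) * f k = ∑ k ∈ range (d + 1), (m.choose k : ℤ) * f k := by
  rcases le_total m d with h | h
  · refine sum_subset (range_mono (by omega)) fun k _ hk => ?_
    rw [mem_range, not_lt] at hk
    rw [Nat.choose_eq_zero_of_lt (by omega)]
    simp
  · refine (sum_subset (range_mono (by omega)) fun k _ hk => ?_).symm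
    rw [mem_range, not_lt] at hk
    rw [hf k (by omega), mul_zero]

/-- A sum over sets of normal vectors, grouped by their support: sets with support of size `k`
contribute as the sets of full support in dimension `k`. -/
theorem sum_powerset_midNormals_eq_sum_choose {P : ∀ n, Finset (Fin n → ℤ) → Prop}
    [∀ n, DecidablePred (P n)]
    (hP : ∀ {k n : ℕ} (e : Fin k ↪o Fin n) (B : Finset (Fin k → ℤ)),
      P n (B.image (extendVec e)) ↔ P k B) (m : ℕ) :
    ∑ B ∈ (midNormals m).powerset with P m B, (-1 : ℤ) ^ #B =
      ∑ k ∈ range (m + 1), (m.choose k : ℤ) *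
        ∑ B ∈ (midNormals k).powerset with P k B ∧ vecSupport B = univ, (-1 : ℤ) ^ #B := by
  have h1 : ∀ J : Finset (Fin m),
      ∑ B ∈ (midNormals m).powerset with P m B ∧ vecSupport B = J, (-1 : ℤ) ^ #B =
        ∑ B ∈ (midNormals #J).powerset with P #J B ∧ vecSupport B = univ, (-1 : ℤ) ^ #B := by
    intro J
    -- The embedding must be monotone, since the sign conventions for normals refer to the order of
    -- the indices.
    let e := J.orderEmbOfFin rfl
    have hrange : ∀ i, i ∈ Set.range e ↔ i ∈ J := fun i => by
      rw [range_orderEmbOfFin, mem_coe]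
    symm
    refine sum_bij (fun B _ => B.image (extendVec e)) ?_ ?_ ?_ ?_
    · intro B hB
      simp only [mem_filter, mem_powerset] at hB ⊢
      refine ⟨?_, (hP e B).2 hB.2.1, ?_⟩
      · intro w hw
        obtain ⟨v, hv, rfl⟩ := mem_image.1 hw
        exact ((mem_midNormals_iff_exists_extendVec e).1 ⟨v, hB.1 hv, rfl⟩).1
      · ext i
        rw [mem_vecSupport_image_extendVec, hB.2.2, ← hrange]
        simp
    · intro B _ B' _ h
      exact image_injective (extendVec_injective e) h
    · intro B hB
      simp only [mem_filter, mem_powerset] at hB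
      have hsub : ∀ w ∈ B, ∃ v ∈ midNormals #J, extendVec e v = w := fun w hw =>
        (mem_midNormals_iff_exists_extendVec e).2 ⟨hB.1 hw, fun i hi => by
          rw [hrange, ← hB.2.2, mem_vecSupport]
          exact ⟨w, hw, hi⟩⟩
      have himage : ((midNormals #J).filter fun v => extendVec e v ∈ B).image (extendVec e)
          = B := by
        ext w
        simp only [mem_image, mem_filter]
        constructor
        · rintro ⟨v, hv, rfl⟩
          exact hv.2
        · intro hw
          obtain ⟨v, hv, rfl⟩ := hsub w hw
          exact ⟨v, ⟨hv, hw⟩, rfl⟩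
      refine ⟨_, ?_, himage⟩
      simp only [mem_filter, mem_powerset]
      refine ⟨filter_subset _ _, (hP e _).1 (by rw [himage]; exact hB.2.1), ?_⟩
      rw [eq_univ_iff_forall]
      intro j
      have hj : e j ∈ vecSupport B := by
        rw [hB.2.2, ← hrange]
        exact ⟨j, rfl⟩
      rw [← himage, mem_vecSupport_image_extendVec] at hj
      obtain ⟨j', hj', h⟩ := hj
      exact e.injective h ▸ hj'
    · intro B _
      rw [card_image_of_injective _ (extendVec_injective e)]
  have h2 := sum_powerset_apply_card (x := (univ : Finset (Fin m))) fun k =>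
    ∑ B ∈ (midNormals k).powerset with P k B ∧ vecSupport B = univ, (-1 : ℤ) ^ #B
  rw [card_univ, Fintype.card_fin] at h2
  simp_rw [nsmul_eq_mul] at h2
  rw [← h2, powerset_univ, ← sum_congr rfl fun J _ => h1 J,
    ← sum_fiberwise _ vecSupport]
  simp_rw [filter_filter]

/-- Take three distinct members `v, w, u`; rank two gives `u = a v + b w`, with `a, b ≠ 0` by
non-proportionality. A coordinate where two of the three vanish kills the third and hence the whole
span. So each coordinate in the support is nonzero in at least two of them, and each has at most
four nonzero entries: `2 * #supp ≤ 12`. -/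
theorem card_vecSupport_le_six {B : Finset (Fin m → ℤ)} (hB : B ⊆ midNormals m)
    (hrank : normalRank ℝ B = 2) (hcard : 3 ≤ #B) : #(vecSupport B) ≤ 6 := by
  obtain ⟨v, hv, w, hw, u, hu, hvw, hvu, hwu⟩ := two_lt_card.1 hcard
  have hspan : Submodule.span ℝ (castVec ℝ '' (({v, w} : Finset (Fin m → ℤ)) : Set (Fin m → ℤ)))
      = Submodule.span ℝ (castVec ℝ '' (B : Set (Fin m → ℤ))) := by
    refine Submodule.eq_of_le_of_finrank_eq (Submodule.span_mono (Set.image_mono ?_)) ?_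
    · simp [Set.insert_subset_iff, hv, hw]
    · exact (normalRank_pair (hB hv) (hB hw) hvw).trans hrank.symm
  have hcomb : ∀ t ∈ B, ∃ a b : ℝ, ∀ i, a * v i + b * w i = t i := by
    intro t ht
    have h1 : castVec ℝ t ∈ Submodule.span ℝ (castVec ℝ '' (B : Set (Fin m → ℤ))) :=
      Submodule.subset_span ⟨t, ht, rfl⟩
    rw [← hspan, coe_pair, Set.image_pair, Submodule.mem_span_pair] at h1
    obtain ⟨a, b, h⟩ := h1
    exact ⟨a, b, fun i => congrFun h i⟩
  obtain ⟨a, b, hab⟩ := hcomb u hu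
  have ha : a ≠ 0 := by
    rintro rfl
    have := eq_zero_of_smul_eq_smul (F := ℝ) (hB hu) (hB hw) hwu.symm (a := 1) (b := b)
      fun i => by linear_combination -hab i
    exact one_ne_zero this.1
  have hb : b ≠ 0 := by
    rintro rfl
    have := eq_zero_of_smul_eq_smul (F := ℝ) (hB hu) (hB hv) hvu.symm (a := 1) (b := a)
      fun i => by linear_combination -hab i
    exact one_ne_zero this.1
  have htwice : ∀ i ∈ vecSupport B, 2 ≤ (if v i ≠ 0 then 1 else 0) +
      (if w i ≠ 0 then 1 else 0) + (if u i ≠ 0 then 1 else 0) := by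
    intro i hi
    obtain ⟨t, ht, hti⟩ := mem_vecSupport.1 hi
    obtain ⟨a', b', ht'⟩ := hcomb t ht
    have h1 := hab i
    have h2 := ht' i
    by_cases hvi : v i = 0
    · by_cases hwi : w i = 0
      · exfalso
        simp only [hvi, hwi, Int.cast_zero, mul_zero, add_zero] at h2
        exact hti (by exact_mod_cast h2.symm)
      · have hui : u i ≠ 0 := by
          intro hui
          simp [hvi, hui, hb, hwi] at h1
        simp [hvi, hwi, hui]
    · by_cases hwi : w i = 0
      · have hui : u i ≠ 0 := by
          intro hui
          simp [hwi, hui, ha, hvi] at h1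
        simp [hvi, hwi, hui]
      · simp [hvi, hwi]
  have h3 := sum_le_sum htwice
  rw [sum_const, smul_eq_mul] at h3
  have h4 := h3.trans (sum_le_sum_of_subset (subset_univ (vecSupport B)))
  rw [sum_add_distrib, sum_add_distrib, ← card_filter, ← card_filter, ← card_filter] at h4
  have h5 := card_support_le_of_mem_midNormals (hB hv)
  have h6 := card_support_le_of_mem_midNormals (hB hw)
  have h7 := card_support_le_of_mem_midNormals (hB hu)
  omega

/-- The part of `dependentRankTwoSum` that comes from families involving all coordinates. -/
noncomputable def fullDependentRankTwoSum (k : ℕ) : ℤ :=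
  ∑ B ∈ (midNormals k).powerset with (normalRank ℝ B = 2 ∧ 3 ≤ #B) ∧ vecSupport B = univ,
    (-1 : ℤ) ^ #B

theorem dependentRankTwoSum_eq_sum_choose (m : ℕ) :
    dependentRankTwoSum m
      = ∑ k ∈ range (m + 1), (m.choose k : ℤ) * fullDependentRankTwoSum k := by
  refine sum_powerset_midNormals_eq_sum_choose
    (P := fun n B => normalRank ℝ B = 2 ∧ 3 ≤ #B) (fun e B => ?_) m
  rw [normalRank_image_extendVec, card_image_of_injective _ (extendVec_injective e)]

theorem fullDependentRankTwoSum_eq_zero {k : ℕ} (hk : 6 < k) : fullDependentRankTwoSum k = 0 := by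
  rw [fullDependentRankTwoSum, filter_false_of_mem, sum_empty]
  rintro B hB ⟨⟨h1, h2⟩, h3⟩
  have := card_vecSupport_le_six (mem_powerset.1 hB) h1 h2
  rw [h3, card_univ, Fintype.card_fin] at this
  omega

theorem fullDependentRankTwoSum_eq_zero_of_card_lt {k : ℕ} (hk : #(midNormals k) < 3) :
    fullDependentRankTwoSum k = 0 := by
  rw [fullDependentRankTwoSum, filter_false_of_mem, sum_empty]
  rintro B hB ⟨⟨-, h2⟩, -⟩
  have := card_le_card (mem_powerset.1 hB)
  omega

theorem sum_powerset_filter_card_eq_one {α : Type*} [DecidableEq α] (s : Finset α)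
    (p : Finset α → Prop) [DecidablePred p] :
    ∑ B ∈ s.powerset with #B = 1 ∧ p B, (-1 : ℤ) ^ #B = -#{v ∈ s | p {v}} := by
  have h : s.powerset.filter (fun B => #B = 1 ∧ p B) = {v ∈ s | p {v}}.image singleton := by
    ext B
    simp only [mem_filter, mem_powerset, mem_image, card_eq_one]
    constructor
    · rintro ⟨h1, ⟨v, rfl⟩, h2⟩
      exact ⟨v, ⟨singleton_subset_iff.1 h1, h2⟩, rfl⟩
    · rintro ⟨v, ⟨h1, h2⟩, rfl⟩
      exact ⟨singleton_subset_iff.2 h1, ⟨v, rfl⟩, h2⟩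
  rw [h, sum_image singleton_injective.injOn]
  simp

/-- Group the normals by support: one has full support in dimension 2, three in dimension 4, and
none in the other dimensions. -/
theorem card_midNormals (m : ℕ) : #(midNormals m) = m.choose 2 + 3 * m.choose 4 := by
  have h := sum_powerset_midNormals_eq_sum_choose (P := fun _ B => #B = 1)
    (fun e B => by rw [card_image_of_injective _ (extendVec_injective e)]) m
  have hleft := sum_powerset_filter_card_eq_one (midNormals m) fun _ => True
  simp only [and_true, filter_true] at hleft
  rw [hleft] at h
  simp_rw [sum_powerset_filter_card_eq_one] at h
  have hbig : ∀ k, 4 < k → #{v ∈ midNormals k | vecSupport {v} = univ} = 0 := by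
    intro k hk
    rw [card_eq_zero, filter_eq_empty_iff]
    intro v hv hsupp
    have h1 := card_support_le_of_mem_midNormals hv
    have h2 : vecSupport {v} = univ.filter fun i => v i ≠ 0 := by
      ext i
      simp [mem_vecSupport]
    rw [← h2, hsupp, card_univ, Fintype.card_fin] at h1
    omega
  have h0 : #{v ∈ midNormals 0 | vecSupport {v} = univ} = 0 := by decide +kernel
  have h1 : #{v ∈ midNormals 1 | vecSupport {v} = univ} = 0 := by decide +kernel
  have h2 : #{v ∈ midNormals 2 | vecSupport {v} = univ} = 1 := by decide +kernel
  have h3 : #{v ∈ midNormals 3 | vecSupport {v} = univ} = 0 := by decide +kernel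
  have h4 : #{v ∈ midNormals 4 | vecSupport {v} = univ} = 3 := by decide +kernel
  have hsum := sum_range_choose_mul_eq_of_eq_zero
    (f := fun k => -(#{v ∈ midNormals k | vecSupport {v} = univ} : ℤ)) (d := 4)
    (fun k hk => by rw [hbig k hk]; rfl) m
  rw [hsum] at h
  simp only [sum_range_succ, range_zero, sum_empty, h0, h1, h2, h3, h4] at h
  push_cast at h
  zify
  linarith

end Transport

/-! ### Recognizing a polynomial from top coefficients and values. -/

section Factorization

theorem Polynomial.natDegree_multisetProd_X_sub_C {R : Type*} [CommRing R] [Nontrivial R]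
    (s : Multiset R) : (s.map fun a => X - C a).prod.natDegree = s.card :=
  natDegree_multiset_prod_X_sub_C_eq_card s

theorem Polynomial.coeff_multisetProd_X_sub_C_card {R : Type*} [CommRing R] [Nontrivial R]
    (s : Multiset R) : (s.map fun a => X - C a).prod.coeff s.card = 1 := by
  have h := (monic_multiset_prod_of_monic s (fun a => X - C a) fun a _ => monic_X_sub_C a)
  have h2 := h.coeff_natDegree
  rwa [natDegree_multisetProd_X_sub_C] at h2

/-- Newton's identity between the second elementary symmetric function and the power sums of the
roots. -/
theorem Polynomial.two_mul_coeff_multisetProd_X_sub_C {R : Type*} [CommRing R] [Nontrivial R]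
    (s : Multiset R) (hs : 2 ≤ s.card) :
    2 * (s.map fun a => X - C a).prod.coeff (s.card - 2)
      = s.sum ^ 2 - (s.map fun a => a ^ 2).sum := by
  induction s using Multiset.induction with
  | empty => simp at hs
  | cons a s ih =>
    rw [Multiset.card_cons] at hs ⊢
    simp only [Multiset.map_cons, Multiset.prod_cons, Multiset.sum_cons]
    rcases Nat.lt_or_ge s.card 2 with h | h
    · obtain ⟨b, rfl⟩ := Multiset.card_eq_one.1 (by omega : s.card = 1)
      simp
      ring
    · have h1 : s.card + 1 - 2 = (s.card - 2) + 1 := by omega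
      have h2 : s.card - 2 + 1 = s.card - 1 := by omega
      rw [h1, sub_mul, coeff_sub, coeff_X_mul, coeff_C_mul, h2,
        multiset_prod_X_sub_C_coeff_card_pred s (by omega), mul_sub, ih h]
      ring

theorem isProductOfLinearFactors_multisetProd (s : Multiset ℤ) :
    IsProductOfLinearFactors (s.map fun a => X - C a).prod := by
  refine ⟨_, fun g hg => ?_, rfl⟩
  obtain ⟨a, -, rfl⟩ := Multiset.mem_map.1 hg
  exact degree_X_sub_C a

/-- Agreement of the top `d` coefficients leaves a difference of degree less than `m + 1 - d`, which
cannot vanish at that many points unless it is zero. -/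
theorem Polynomial.eq_of_coeff_eq_of_eval_eq {f g : ℤ[X]} {m d : ℕ} (hf : f.natDegree ≤ m)
    (hg : g.natDegree ≤ m) (hc : ∀ r < d, f.coeff (m - r) = g.coeff (m - r)) (s : Finset ℤ)
    (hs : m + 1 ≤ #s + d) (heval : ∀ x ∈ s, f.eval x = g.eval x) : f = g := by
  refine eq_of_degree_sub_lt_of_eval_finset_eq s ?_ heval
  rw [degree_lt_iff_coeff_zero]
  intro n hn
  rw [coeff_sub, sub_eq_zero]
  rcases Nat.lt_or_ge m n with h | h
  · rw [coeff_eq_zero_of_natDegree_lt (hf.trans_lt h),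
      coeff_eq_zero_of_natDegree_lt (hg.trans_lt h)]
  · have := hc (m - n) (by omega)
    rwa [Nat.sub_sub_self h] at this

/-- The leading coefficient and the number of hyperplanes fix two coefficients, so `m - 1` points
suffice; knowing the coefficient of `t^(m-2)` saves one more point. -/
theorem arrangementCharPoly_eq_multisetProd {m : ℕ} {s : Multiset ℤ} (hm : 2 ≤ m)
    (hcard : s.card = m) (hsum : s.sum = m.choose 2 + 3 * m.choose 4) (t : Finset ℤ)
    (ht : m ≤ #t + 1 ∨ m ≤ #t + 2 ∧ s.sum ^ 2 - (s.map fun a => a ^ 2).sum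
      = s.sum * (s.sum - 1) + 2 * dependentRankTwoSum m)
    (heval : ∀ x ∈ t, (arrangementCharPoly (midHyperplaneArrangement ℝ m)).eval x
      = (s.map fun a => X - C a).prod.eval x) :
    arrangementCharPoly (midHyperplaneArrangement ℝ m) = (s.map fun a => X - C a).prod := by
  set f := arrangementCharPoly (midHyperplaneArrangement ℝ m)
  set g := (s.map fun a => X - C a).prod with hg
  have hfdeg : f.natDegree ≤ m := natDegree_arrangementCharPoly_le m
  have hgdeg : g.natDegree ≤ m := (natDegree_multisetProd_X_sub_C s).trans hcard |>.le
  have h0 : f.coeff m = g.coeff m := by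
    rw [coeff_arrangementCharPoly_self, ← hcard, coeff_multisetProd_X_sub_C_card]
  have hn : (#(midNormals m) : ℤ) = s.sum := by
    rw [card_midNormals, hsum]
    push_cast
    rfl
  have h1 : f.coeff (m - 1) = g.coeff (m - 1) := by
    rw [coeff_arrangementCharPoly_sub_one m (by omega), ← hcard,
      multiset_prod_X_sub_C_coeff_card_pred s (by omega), hcard, hn]
  rcases ht with ht | ⟨ht, h2⟩
  · refine eq_of_coeff_eq_of_eval_eq hfdeg hgdeg (d := 2) (fun r hr => ?_) t (by omega) heval
    interval_cases r
    · exact h0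
    · exact h1
  · refine eq_of_coeff_eq_of_eval_eq hfdeg hgdeg (d := 3) (fun r hr => ?_) t (by omega) heval
    interval_cases r
    · exact h0
    · exact h1
    · have h3 := two_mul_coeff_multisetProd_X_sub_C s (by omega)
      rw [hcard, ← hg, h2, ← hn] at h3
      have h4 : (2 : ℤ) * (#(midNormals m)).choose 2
          = #(midNormals m) * (#(midNormals m) - 1) := by
        have h5 := Nat.choose_two_right #(midNormals m)
        have h6 := Nat.even_mul_pred_self #(midNormals m)
        have h7 : #(midNormals m) * (#(midNormals m) - 1) = 2 * (#(midNormals m)).choose 2 := by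
          rw [h5, Nat.mul_div_cancel' h6.two_dvd]
        rcases Nat.eq_zero_or_pos #(midNormals m) with h8 | h8
        · simp [h8]
        · zify [h8] at h7
          exact h7.symm
      rw [coeff_arrangementCharPoly_sub_two m hm]
      linarith

end Factorization

/-! ### Explicit factorizations for `m = 3, …, 7`. -/

section SmallDimensions

theorem eval_arrangementCharPoly_of_countExtensions {q : ℕ} (hp : q.Prime) (hq2 : 2 < q)
    {k c : ℕ} (hqm : ¬ q ∣ k + 2) (hq : 4 ^ (k + 1) < q ^ 2 * (k + 2))
    (hc : countExtensions q (q - 2) k 2 (1 ||| 2) (2 ||| 2 ^ (q - 1)) 2 (1 ||| 2)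
      (1 ||| 2 ^ (q - 1)) = c) :
    (arrangementCharPoly (midHyperplaneArrangement ℝ (k + 2))).eval (q : ℤ)
      = k.factorial * (q * (q - 1)) * c := by
  have : Fact q.Prime := ⟨hp⟩
  rw [eval_arrangementCharPoly_eq_countExtensions hq2 hqm hq, hc]

theorem arrangementCharPoly_three : arrangementCharPoly (midHyperplaneArrangement ℝ 3)
    = (({0, 1, 2} : Multiset ℤ).map fun a => X - C a).prod := by
  refine arrangementCharPoly_eq_multisetProd (by norm_num) rfl (by decide) {0, 1}
    (Or.inl (by decide)) ?_
  intro x hx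
  simp only [mem_insert, mem_singleton] at hx
  rcases hx with rfl | rfl
  · rw [eval_zero_arrangementCharPoly 3 (by norm_num)]
    simp
  · rw [eval_one_arrangementCharPoly 3 (by norm_num)]
    simp

theorem arrangementCharPoly_four : arrangementCharPoly (midHyperplaneArrangement ℝ 4)
    = (({0, 1, 3, 5} : Multiset ℤ).map fun a => X - C a).prod := by
  refine arrangementCharPoly_eq_multisetProd (by norm_num) rfl (by decide) {0, 1, 5}
    (Or.inl (by decide)) ?_
  have h5 := eval_arrangementCharPoly_of_countExtensions (q := 5) (k := 2) (c := 0)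
    (by norm_num) (by norm_num) (by norm_num) (by norm_num) (by decide +kernel)
  intro x hx
  simp only [mem_insert, mem_singleton] at hx
  rcases hx with rfl | rfl | rfl
  · rw [eval_zero_arrangementCharPoly 4 (by norm_num)]
    simp
  · rw [eval_one_arrangementCharPoly 4 (by norm_num)]
    simp
  · refine h5.trans ?_
    simp

theorem arrangementCharPoly_five : arrangementCharPoly (midHyperplaneArrangement ℝ 5)
    = (({0, 1, 7, 8, 9} : Multiset ℤ).map fun a => X - C a).prod := by
  refine arrangementCharPoly_eq_multisetProd (by norm_num) rfl (by decide) {0, 1, 11, 13}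
    (Or.inl (by decide)) ?_
  -- The smallest admissible primes are 11 and 13: the prime 7 fails because `7^2 * 5 = 245 < 256 =
  -- 4^4`.
  have h11 := eval_arrangementCharPoly_of_countExtensions (q := 11) (k := 3) (c := 4)
    (by norm_num) (by norm_num) (by norm_num) (by norm_num) (by decide +kernel)
  have h13 := eval_arrangementCharPoly_of_countExtensions (q := 13) (k := 3) (c := 20)
    (by norm_num) (by norm_num) (by norm_num) (by norm_num) (by decide +kernel)
  intro x hx
  simp only [mem_insert, mem_singleton] at hx
  rcases hx with rfl | rfl | rfl | rfl
  · rw [eval_zero_arrangementCharPoly 5 (by norm_num)]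
    simp
  · rw [eval_one_arrangementCharPoly 5 (by norm_num)]
    simp
  · refine h11.trans ?_
    norm_num [Nat.factorial]
  · refine h13.trans ?_
    norm_num [Nat.factorial]

theorem arrangementCharPoly_six : arrangementCharPoly (midHyperplaneArrangement ℝ 6)
    = (({0, 1, 13, 14, 15, 17} : Multiset ℤ).map fun a => X - C a).prod := by
  refine arrangementCharPoly_eq_multisetProd (by norm_num) rfl (by decide) {0, 1, 17, 19, 23}
    (Or.inl (by decide)) ?_
  -- Here 13 just fails: `13^2 * 6 = 1014 < 1024 = 4^5`.
  have h17 := eval_arrangementCharPoly_of_countExtensions (q := 17) (k := 4) (c := 0)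
    (by norm_num) (by norm_num) (by norm_num) (by norm_num) (by decide +kernel)
  have h19 := eval_arrangementCharPoly_of_countExtensions (q := 19) (k := 4) (c := 10)
    (by norm_num) (by norm_num) (by norm_num) (by norm_num) (by decide +kernel)
  have h23 := eval_arrangementCharPoly_of_countExtensions (q := 23) (k := 4) (c := 180)
    (by norm_num) (by norm_num) (by norm_num) (by norm_num) (by decide +kernel)
  intro x hx
  simp only [mem_insert, mem_singleton] at hx
  rcases hx with rfl | rfl | rfl | rfl | rfl
  · rw [eval_zero_arrangementCharPoly 6 (by norm_num)]
    simp
  · rw [eval_one_arrangementCharPoly 6 (by norm_num)]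
    simp
  · refine h17.trans ?_
    simp
  · refine h19.trans ?_
    norm_num [Nat.factorial]
  · refine h23.trans ?_
    norm_num [Nat.factorial]

/-- The second coefficient of a factored characteristic polynomial. -/
theorem two_mul_dependentRankTwoSum {m : ℕ} {s : Multiset ℤ} (hm : 2 ≤ m) (hcard : s.card = m)
    (h : arrangementCharPoly (midHyperplaneArrangement ℝ m) = (s.map fun a => X - C a).prod) :
    2 * dependentRankTwoSum m = s.sum ^ 2 - (s.map fun a => a ^ 2).sum
      - 2 * ((m.choose 2 + 3 * m.choose 4).choose 2 : ℕ) := by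
  have h1 := two_mul_coeff_multisetProd_X_sub_C s (by omega)
  rw [← h, hcard, coeff_arrangementCharPoly_sub_two m hm, card_midNormals] at h1
  linarith

/-- This value and the next three are read off the factorizations, without enumerating dependent
families. -/
theorem dependentRankTwoSum_three : dependentRankTwoSum 3 = -1 := by
  have h := two_mul_dependentRankTwoSum (m := 3) (by norm_num) (by rfl) arrangementCharPoly_three
  have h2 : (3 : ℕ).choose 2 + 3 * (3 : ℕ).choose 4 = 3 := by decide
  rw [h2, show Nat.choose 3 2 = 3 by decide] at h
  norm_num at h
  linarith

theorem dependentRankTwoSum_four : dependentRankTwoSum 4 = -13 := by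
  have h := two_mul_dependentRankTwoSum (m := 4) (by norm_num) (by rfl) arrangementCharPoly_four
  have h2 : (4 : ℕ).choose 2 + 3 * (4 : ℕ).choose 4 = 9 := by decide
  rw [h2, show Nat.choose 9 2 = 36 by decide] at h
  norm_num at h
  linarith

theorem dependentRankTwoSum_five : dependentRankTwoSum 5 = -85 := by
  have h := two_mul_dependentRankTwoSum (m := 5) (by norm_num) (by rfl) arrangementCharPoly_five
  have h2 : (5 : ℕ).choose 2 + 3 * (5 : ℕ).choose 4 = 25 := by decide
  rw [h2, show Nat.choose 25 2 = 300 by simp [Nat.choose]] at h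
  norm_num at h
  linarith

theorem dependentRankTwoSum_six : dependentRankTwoSum 6 = -410 := by
  have h := two_mul_dependentRankTwoSum (m := 6) (by norm_num) (by rfl) arrangementCharPoly_six
  have h2 : (6 : ℕ).choose 2 + 3 * (6 : ℕ).choose 4 = 60 := by decide
  rw [h2, show Nat.choose 60 2 = 1770 by simp [Nat.choose]] at h
  norm_num at h
  linarith

/-- Supports have at most six coordinates, and below dimension 3 there are fewer than three normals.
This leaves four unknown coefficients of `m.choose k`, solved from the values at `m = 3, 4, 5, 6`, a
triangular system. -/
theorem dependentRankTwoSum_eq (m : ℕ) : dependentRankTwoSum m =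
    -(m.choose 3 + 9 * m.choose 4 + 30 * m.choose 5 + 75 * m.choose 6) := by
  have hsum : ∀ n, dependentRankTwoSum n
      = ∑ k ∈ range 7, (n.choose k : ℤ) * fullDependentRankTwoSum k := fun n =>
    (dependentRankTwoSum_eq_sum_choose n).trans
      (sum_range_choose_mul_eq_of_eq_zero (fun k hk => fullDependentRankTwoSum_eq_zero hk) n)
  have h0 : fullDependentRankTwoSum 0 = 0 :=
    fullDependentRankTwoSum_eq_zero_of_card_lt (by rw [card_midNormals]; decide)
  have h1 : fullDependentRankTwoSum 1 = 0 :=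
    fullDependentRankTwoSum_eq_zero_of_card_lt (by rw [card_midNormals]; decide)
  have h2 : fullDependentRankTwoSum 2 = 0 :=
    fullDependentRankTwoSum_eq_zero_of_card_lt (by rw [card_midNormals]; decide)
  simp only [sum_range_succ, range_zero, sum_empty, h0, h1, h2] at hsum
  have h3 := hsum 3
  have h4 := hsum 4
  have h5 := hsum 5
  have h6 := hsum 6
  rw [dependentRankTwoSum_three] at h3
  rw [dependentRankTwoSum_four] at h4
  rw [dependentRankTwoSum_five] at h5
  rw [dependentRankTwoSum_six] at h6
  norm_num [Nat.choose] at h3 h4 h5 h6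
  have e3 : fullDependentRankTwoSum 3 = -1 := by linarith
  have e4 : fullDependentRankTwoSum 4 = -9 := by linarith
  have e5 : fullDependentRankTwoSum 5 = -30 := by linarith
  have e6 : fullDependentRankTwoSum 6 = -75 := by linarith
  rw [hsum m, e3, e4, e5, e6]
  ring

theorem arrangementCharPoly_seven : arrangementCharPoly (midHyperplaneArrangement ℝ 7)
    = (({0, 1, 23, 24, 25, 26, 27} : Multiset ℤ).map fun a => X - C a).prod := by
  -- The coefficient of `t^5` is known, so three primes suffice and a larger search at a fourth is
  -- avoided. The prime 23 is excluded by `23^2 * 7 = 3703 < 4096 = 4^6`.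
  refine arrangementCharPoly_eq_multisetProd (by norm_num) rfl (by decide) {0, 1, 29, 31, 37}
    (Or.inr ⟨by decide, ?_⟩) ?_
  · rw [dependentRankTwoSum_eq]
    norm_num [Nat.choose]
  have h29 := eval_arrangementCharPoly_of_countExtensions (q := 29) (k := 5) (c := 6)
    (by norm_num) (by norm_num) (by norm_num) (by norm_num) (by decide +kernel)
  have h31 := eval_arrangementCharPoly_of_countExtensions (q := 31) (k := 5) (c := 56)
    (by norm_num) (by norm_num) (by norm_num) (by norm_num) (by decide +kernel)
  have h37 := eval_arrangementCharPoly_of_countExtensions (q := 37) (k := 5) (c := 2002)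
    (by norm_num) (by norm_num) (by norm_num) (by norm_num) (by decide +kernel)
  intro x hx
  simp only [mem_insert, mem_singleton] at hx
  rcases hx with rfl | rfl | rfl | rfl | rfl
  · rw [eval_zero_arrangementCharPoly 7 (by norm_num)]
    simp
  · rw [eval_one_arrangementCharPoly 7 (by norm_num)]
    simp
  · refine h29.trans ?_
    norm_num [Nat.factorial]
  · refine h31.trans ?_
    norm_num [Nat.factorial]
  · refine h37.trans ?_
    norm_num [Nat.factorial]

end SmallDimensions

/-! ### No factorization for `m ≥ 8`. -/

section LargeDimensions

theorem Multiset.sq_sum_le_card_mul_sum_sq (s : Multiset ℝ) :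
    s.sum ^ 2 ≤ s.card * (s.map fun a => a ^ 2).sum := by
  induction s using Quotient.inductionOn with
  | h l =>
    have h := _root_.sq_sum_le_card_mul_sum_sq (s := (univ : Finset (Fin l.length)))
      (f := fun i => l[i])
    rw [card_univ, Fintype.card_fin] at h
    have h2 : ∑ i : Fin l.length, l[i] ^ 2 = (l.map fun a => a ^ 2).sum :=
      Fin.sum_univ_fun_getElem l fun a => a ^ 2
    rw [h2] at h
    simpa using h

/-- Real-rootedness bounds the second coefficient, by the Cauchy-Schwarz inequality applied to
the roots other than `0` and `1`. -/
theorem sq_card_sub_one_le_of_isProductOfLinearFactors {m : ℕ} (hm : 3 ≤ m)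
    (h : IsProductOfLinearFactors (arrangementCharPoly (midHyperplaneArrangement ℝ m))) :
    ((#(midNormals m) : ℝ) - 1) ^ 2 ≤
      (m - 2) * (#(midNormals m) - 1 - 2 * dependentRankTwoSum m) := by
  set f := arrangementCharPoly (midHyperplaneArrangement ℝ m) with hf
  set n := #(midNormals m) with hn
  let φ := Int.castRingHom ℝ
  have hsplit : (f.map φ).Splits := by
    obtain ⟨s, hs, hfs⟩ := h
    rw [hfs, Polynomial.map_multiset_prod]
    refine Splits.multisetProd fun p hp => ?_
    obtain ⟨g, hg, rfl⟩ := Multiset.mem_map.1 hp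
    refine Splits.of_degree_eq_one ?_
    rw [degree_map_eq_of_injective (RingHom.injective_int φ), hs g hg]
  have hmonic : (f.map φ).Monic := (monic_arrangementCharPoly m).map φ
  have hprod := hsplit.eq_prod_roots_of_monic hmonic
  have hcard : (f.map φ).roots.card = m := by
    rw [← hsplit.natDegree_eq_card_roots, (monic_arrangementCharPoly m).natDegree_map,
      natDegree_arrangementCharPoly]
  have hroot : ∀ a : ℤ, f.eval a = 0 → (a : ℝ) ∈ (f.map φ).roots := by
    intro a ha
    rw [mem_roots hmonic.ne_zero, IsRoot, eval_map]
    have := Polynomial.eval₂_at_apply φ (p := f) a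
    rw [ha, map_zero] at this
    exact this
  have h0 := hroot 0 (eval_zero_arrangementCharPoly m (by omega))
  have h1 := hroot 1 (eval_one_arrangementCharPoly m (by omega))
  obtain ⟨r, hr⟩ := Multiset.exists_cons_of_mem h0
  rw [hr, Multiset.mem_cons] at h1
  obtain ⟨t, ht⟩ := Multiset.exists_cons_of_mem (h1.resolve_left (by norm_num))
  rw [ht] at hr
  have hsum : (f.map φ).roots.sum = n := by
    have := multiset_prod_X_sub_C_coeff_card_pred (f.map φ).roots (by omega)
    rw [← hprod, hcard, coeff_map, coeff_arrangementCharPoly_sub_one m (by omega)] at this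
    simp only [φ, eq_intCast, Int.cast_neg, Int.cast_natCast, neg_inj] at this
    exact this.symm
  have hsq := two_mul_coeff_multisetProd_X_sub_C (f.map φ).roots (by omega)
  rw [← hprod, hcard, coeff_map, coeff_arrangementCharPoly_sub_two m (by omega), hsum] at hsq
  simp only [φ, eq_intCast, Int.cast_add, Int.cast_natCast, ← hn, Nat.cast_choose_two] at hsq
  rw [hr] at hsum hcard hsq
  simp only [Multiset.sum_cons, Multiset.card_cons, Multiset.map_cons, Int.cast_zero,
    Int.cast_one] at hsum hcard hsq
  have hcs := Multiset.sq_sum_le_card_mul_sum_sq t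
  have ht1 : t.sum = n - 1 := by linarith
  -- The squares of all roots sum to `n^2 - 2 * (n.choose 2 + d) = n - 2 * d`; the root 1 accounts
  -- for the missing 1.
  have ht2 : (t.map fun a => a ^ 2).sum = (n : ℝ) - 1 - 2 * dependentRankTwoSum m := by linarith
  have ht3 : (t.card : ℝ) = m - 2 := by
    rw [← hcard]
    push_cast
    ring
  rwa [ht1, ht2, ht3] at hcs

/-- The Cauchy-Schwarz bound fails: at `m = 8` it would read `56169 ≤ 55014`, whereas at `m = 7` it
still holds, as `15625 ≤ 15675`. -/
theorem not_isProductOfLinearFactors_of_eight_le {m : ℕ} (hm : 8 ≤ m) :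
    ¬ IsProductOfLinearFactors (arrangementCharPoly (midHyperplaneArrangement ℝ m)) := by
  intro h
  have key := sq_card_sub_one_le_of_isProductOfLinearFactors (by omega) h
  rw [card_midNormals, dependentRankTwoSum_eq] at key
  obtain ⟨k, rfl⟩ := Nat.exists_eq_add_of_le' hm
  have hdesc : ∀ j, ((k + 8).descFactorial j : ℝ) = j.factorial * (k + 8).choose j := by
    intro j
    exact_mod_cast Nat.descFactorial_eq_factorial_mul_choose (k + 8) j
  have h2 := hdesc 2
  have h3 := hdesc 3
  have h4 := hdesc 4
  have h5 := hdesc 5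
  have h6 := hdesc 6
  simp only [Nat.descFactorial, Nat.reduceSubDiff, Nat.factorial] at h2 h3 h4 h5 h6
  push_cast at h2 h3 h4 h5 h6 key
  have e2 : ((k + 8).choose 2 : ℝ) = (k + 7) * (k + 8) / 2 := by linarith
  have e3 : ((k + 8).choose 3 : ℝ) = (k + 6) * ((k + 7) * (k + 8)) / 6 := by linarith
  have e4 : ((k + 8).choose 4 : ℝ) = (k + 5) * ((k + 6) * ((k + 7) * (k + 8))) / 24 := by
    linarith
  have e5 : ((k + 8).choose 5 : ℝ) = (k + 4) * ((k + 5) * ((k + 6) * ((k + 7) * (k + 8)))) / 120 := by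
    linarith
  have e6 : ((k + 8).choose 6 : ℝ)
      = (k + 3) * ((k + 4) * ((k + 5) * ((k + 6) * ((k + 7) * (k + 8))))) / 720 := by
    linarith
  rw [e2, e3, e4, e5, e6] at key
  refine absurd key (not_le.2 (sub_pos.1 ?_))
  -- In the variable `k = m - 8` the difference of the two sides is a polynomial with positive
  -- coefficients.
  ring_nf
  positivity

end LargeDimensions

theorem theorem4p3 (m : ℕ) (hm : 3 ≤ m) :
    IsProductOfLinearFactors (arrangementCharPoly (midHyperplaneArrangement ℝ m)) ↔ m ≤ 7 := by
  constructor
  · intro h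
    by_contra hlt
    exact not_isProductOfLinearFactors_of_eight_le (by omega) h
  · intro h
    interval_cases m
    · rw [arrangementCharPoly_three]
      exact isProductOfLinearFactors_multisetProd _
    · rw [arrangementCharPoly_four]
      exact isProductOfLinearFactors_multisetProd _
    · rw [arrangementCharPoly_five]
      exact isProductOfLinearFactors_multisetProd _
    · rw [arrangementCharPoly_six]
      exact isProductOfLinearFactors_multisetProd _
    · rw [arrangementCharPoly_seven]
      exact isProductOfLinearFactors_multisetProd _
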